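/- Let $n,d$ be coprime integers with $2\le d<n$, let $K$ be an algebraically closed field with $\operatorname{char}(K)\nmid d$, and let $K_0$ be a perfect subfield of $K$. For a polynomial $f\in K_0[x]$ of degree $n$ without repeated roots, let $\mathcal C_{f,d}$ be the smooth projective model of the affine curve $y^d=f(x)$, regarded as a $K_0$-curve, and let $\mathcal O_{f,d}$ be its only point at infinity. The order of a point $\mathcal P\in\mathcal C_{f,d}(K)$ is the order of the class of $(\mathcal P)-(\mathcal O_{f,d})$ in the Jacobian of $\mathcal C_{f,d}$. Put $\ell_0=\lfloor (n+d)/d\rfloor$ and $m_0=d\ell_0$, and assume $n-m_0+\ell_0\ge 0$. Let $f$ be as above and $a\in K_0$. (1) For a point $\mathcal P$ of $\mathcal C_{f,d}$ the following conditions are equivalent. (i) $\mathcal P$ is a $K_0$-point of order $m_0$ with $x(\mathcal P)=a$. (ii) There exist a nonzero $B\in K_0$ and a polynomial $v\in K_0[x]$ of degree $\ell_0$ with leading coefficient $B$ such that $v(a)\ne 0$, $f(x)=-B^d(x-a)^{m_0}+v(x)^d$ and $\mathcal P=(a,v(a))$. In particular, a point as in (i) exists if and only if there are $B$ and $v$ as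 in (ii) (without the condition on $\mathcal P$). In addition, for all $B$, $v$ as in (ii) there is a nonzero polynomial $q\in K_0[x]$ of degree $n-m_0+\ell_0$ such that $q(a)\neq 0$ and $v(x)=B(x-a)^{\ell_0}+q(x)$. (2) Suppose that $\mathcal P$, $B$, $v$, $q$ are as in (1), and put $h(x)=v(a)^{-d}f(x+a)$, $w(x)=v(a)^{-1}v(x+a)$, $r(x)=v(a)^{-1}q(x+a)$ and $\tilde B=B/v(a)$. Then: (a) $h$ is a polynomial of degree $n$ without repeated roots, $h(x)=-\tilde B^d x^{m_0}+w(x)^d$ and $w(x)=\tilde B x^{\ell_0}+r(x)$. (b) $\deg w=\ell_0$, $\deg r=n-m_0+\ell_0<\ell_0$, $w(0)=1$ and $r\neq 0$. (c) The map $(x,y)\mapsto (x_1,y_1)=(x-a,\,y/v(a))$ defines an isomorphism of the affine $K_0$-curves $y^d=f(x)$ and $y_1^d=h(x_1)$, which extends to an isomorphism of $K_0$-curves $\mathcal C_{f,d}\cong\mathcal C_{h,d}$ that sends $\mathcal O_{f,d}$ to $\mathcal O_{h,d}$ and $\mathcal P$ to $\mathcal Q=(0,1)$. (d) $\mathcal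 Q=(0,1)$ is a $K_0$-point of order $m_0$ on $\mathcal C_{h,d}$. -/

import Mathlib

open Polynomial WithZero

/-! ### Points, divisors and the Jacobian of the curve with a given function field -/

/-- A point of the smooth projective model of the function field `F` over `k` (a closed point, if
`k` is not algebraically closed): a discrete valuation of `F`, trivial on `k`, and normalized to
have value group `ℤ`. The valuation is written multiplicatively:
`val g = exp (- ord g)` for `g ≠ 0`, and `val 0 = 0`. -/
@[ext]
structure Place (k F : Type*) [Field k] [Field F] [Algebra k F] where
  val : Valuation F ℤᵐ⁰
  trivial_on_constants : ∀ c : k, c ≠ 0 → val (algebraMap k F c) = 1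
  surjective : Function.Surjective val

namespace Place

variable {k F : Type*} [Field k] [Field F] [Algebra k F]

/-- The order of vanishing of `g` at the point `P` (meaningful for `g ≠ 0`). -/
def ord (P : Place k F) (g : F) : ℤ := -log (P.val g)

/-- The rational function `g` is regular at `P` and takes there the value `c`. -/
def TakesValue (P : Place k F) (g : F) (c : k) : Prop := P.val (g - algebraMap k F c) < 1

theorem ord_one (P : Place k F) : P.ord 1 = 0 := by simp [ord]

theorem ord_mul (P : Place k F) {g h : F} (hg : g ≠ 0) (hh : h ≠ 0) :
    P.ord (g * h) = P.ord g + P.ord h := by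
  have h1 : P.val g ≠ 0 := (Valuation.ne_zero_iff _).2 hg
  have h2 : P.val h ≠ 0 := (Valuation.ne_zero_iff _).2 hh
  simp only [ord, map_mul, log_mul h1 h2]
  ring

theorem ord_inv (P : Place k F) (g : F) : P.ord g⁻¹ = -P.ord g := by
  simp [ord]

end Place

section Jacobian

variable (k F : Type*) [Field k] [Field F] [Algebra k F]

/-- The divisors of degree zero. Over an algebraically closed field of constants every point has
degree one, so that the degree of a divisor is the sum of its coefficients. -/
noncomputable def DegreeZeroDivisors [IsAlgClosed k] : AddSubgroup (Place k F →₀ ℤ) :=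
  (Finsupp.degree : (Place k F →₀ ℤ) →+ ℤ).ker

/-- The principal divisors `div g = ∑ ord_P(g) P`, `g ≠ 0`, inside the divisors of degree zero. -/
noncomputable def PrincipalDivisors [IsAlgClosed k] : AddSubgroup (DegreeZeroDivisors k F) where
  carrier := {D | ∃ g : F, g ≠ 0 ∧ ∀ P : Place k F, D.1 P = P.ord g}
  zero_mem' := ⟨1, one_ne_zero, fun P => by simp [Place.ord_one]⟩
  add_mem' := by
    rintro D E ⟨g, hg, hD⟩ ⟨h, hh, hE⟩
    exact ⟨g * h, mul_ne_zero hg hh, fun P => by simp [Place.ord_mul P hg hh, hD, hE]⟩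
  neg_mem' := by
    rintro D ⟨g, hg, hD⟩
    exact ⟨g⁻¹, inv_ne_zero hg, fun P => by simp [Place.ord_inv, hD]⟩

/-- The group of `k`-points of the Jacobian (`k` algebraically closed): the divisor classes of
degree zero. -/
abbrev JacobianPoints [IsAlgClosed k] : Type _ := DegreeZeroDivisors k F ⧸ PrincipalDivisors k F

variable {k F}

/-- The embedding of the curve in its Jacobian that sends the base point `O` to zero:
`P` goes to the class of `(P) - (O)`. -/
noncomputable def abelJacobi [IsAlgClosed k] (O P : Place k F) : JacobianPoints k F :=
  QuotientAddGroup.mk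
    ⟨Finsupp.single P 1 - Finsupp.single O 1, by simp [DegreeZeroDivisors, AddMonoidHom.mem_ker]⟩

end Jacobian

/-! ### The curves `y ^ d = f(x)` -/

/-- The data defining the curve `C_{f,d} : y ^ d = f(x)` over the field `k`: a polynomial `f` of
degree `n` without repeated roots (in an algebraic closure), where `2 ≤ d < n`, the integers `n`
and `d` are coprime, and the characteristic of `k` does not divide `d`. -/
structure CyclicCover (k : Type*) [Field k] (n d : ℕ) where
  f : k[X]
  two_le : 2 ≤ d
  lt : d < n
  coprime : n.Coprime d
  char_not_dvd : (d : k) ≠ 0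
  natDegree_f : f.natDegree = n
  separable_f : f.Separable

namespace CyclicCover

variable {k : Type*} [Field k] {n d : ℕ} (C : CyclicCover k n d)

/-- The same equation, over a larger field. -/
noncomputable def baseChange (K : Type*) [Field K] [Algebra k K] : CyclicCover K n d where
  f := C.f.map (algebraMap k K)
  two_le := C.two_le
  lt := C.lt
  coprime := C.coprime
  char_not_dvd := by
    have h := (map_ne_zero (algebraMap k K)).2 C.char_not_dvd
    rwa [map_natCast] at h
  natDegree_f := by rw [natDegree_map, C.natDegree_f]
  separable_f := C.separable_f.map

/-- The coordinate ring `k[x, y] / (y ^ d - f(x))` of the plane affine curve. -/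
abbrev CoordRing : Type _ := AdjoinRoot ((X : k[X][X]) ^ d - Polynomial.C C.f)

/-- The coordinate function `x` of the affine curve. -/
noncomputable def coordX : C.CoordRing := AdjoinRoot.of _ X

/-- The coordinate function `y` of the affine curve. -/
noncomputable def coordY : C.CoordRing := AdjoinRoot.root _

/-- The equation `Y ^ d - f(x)` over the field `k(x)`. -/
noncomputable def equation : (RatFunc k)[X] := X ^ d - Polynomial.C (algebraMap k[X] (RatFunc k) C.f)

/-- The field `k(C_{f,d}) = k(x)(y)`, `y ^ d = f(x)`, of rational functions on the curve. -/
abbrev FunField : Type _ := AdjoinRoot C.equation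

theorem f_ne_zero : C.f ≠ 0 := C.separable_f.ne_zero

theorem irreducible_equation : Irreducible C.equation := by
  have hd : d ≠ 0 := by have := C.two_le; omega
  have hmonic : ((X : k[X][X]) ^ d - Polynomial.C C.f).Monic := monic_X_pow_sub_C _ hd
  have hnu : ¬ IsUnit C.f := by
    intro h
    have h1 := natDegree_eq_zero_of_isUnit h
    have h2 := C.natDegree_f
    have h3 := C.lt
    omega
  obtain ⟨p, hp, hpf⟩ := WfDvdMonoid.exists_irreducible_factor hnu C.f_ne_zero
  have hsq : ¬ p * p ∣ C.f := fun h => hp.not_isUnit (C.separable_f.squarefree p h)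
  have hirr : Irreducible ((X : k[X][X]) ^ d - Polynomial.C C.f) := by
    refine irreducible_of_eisenstein_criterion (P := Ideal.span {p})
      ((Ideal.span_singleton_prime hp.ne_zero).2 hp.prime) ?_ ?_ ?_ ?_ hmonic.isPrimitive
    · rw [hmonic.leadingCoeff, Ideal.mem_span_singleton]
      exact fun h => hp.not_isUnit (isUnit_of_dvd_one h)
    · intro m hm
      rw [degree_X_pow_sub_C (Nat.pos_of_ne_zero hd)] at hm
      have hm' : m ≠ d := by
        rintro rfl
        exact lt_irrefl _ hm
      rw [Ideal.mem_span_singleton, coeff_sub, coeff_X_pow, if_neg hm', zero_sub, dvd_neg, coeff_C]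
      split_ifs
      · exact hpf
      · exact dvd_zero _
    · rw [degree_X_pow_sub_C (Nat.pos_of_ne_zero hd)]
      exact_mod_cast Nat.pos_of_ne_zero hd
    · rw [Ideal.span_singleton_pow, Ideal.mem_span_singleton, coeff_sub, coeff_X_pow,
        if_neg hd.symm, zero_sub, dvd_neg, coeff_C_zero, sq]
      exact hsq
  have h := (hmonic.irreducible_iff_irreducible_map_fraction_map (K := RatFunc k)).1 hirr
  simpa [equation] using h

instance : Fact (Irreducible C.equation) := ⟨C.irreducible_equation⟩

/-- The rational function `x` on the curve. -/
noncomputable def x : C.FunField := AdjoinRoot.of _ RatFunc.X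

/-- The rational function `y` on the curve. -/
noncomputable def y : C.FunField := AdjoinRoot.root _

/-- Functions on the affine curve are rational functions on the curve. -/
noncomputable def coordToFun : C.CoordRing →+* C.FunField :=
  AdjoinRoot.map (algebraMap k[X] (RatFunc k)) _ _ (by simp [equation])

/-- The inclusion `k(x) → K(x)`. -/
noncomputable def ratFuncBaseChange (k K : Type*) [Field k] [Field K] [Algebra k K] :
    RatFunc k →+* RatFunc K :=
  RatFunc.mapRingHom (Polynomial.mapRingHom (algebraMap k K))
    (nonZeroDivisors_le_comap_nonZeroDivisors_of_injective _
      (Polynomial.map_injective _ (algebraMap k K).injective))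

/-- The inclusion `k(C_{f,d}) → K(C_{f,d})`, which extends `k → K` and sends `x` to `x` and
`y` to `y`. -/
noncomputable def funBaseChange (K : Type*) [Field K] [Algebra k K] :
    C.FunField →+* (C.baseChange K).FunField :=
  AdjoinRoot.map (ratFuncBaseChange k K) _ _ (by
    simp only [equation, baseChange, ratFuncBaseChange, Polynomial.map_sub, Polynomial.map_pow,
      map_X, map_C, RatFunc.coe_mapRingHom_eq_coe_map]
    have h := RatFunc.map_apply_div (Polynomial.mapRingHom (algebraMap k K))
      (nonZeroDivisors_le_comap_nonZeroDivisors_of_injective _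
        (Polynomial.map_injective _ (algebraMap k K).injective)) C.f 1
    simp only [map_one, div_one] at h
    rw [h]
    rfl)

theorem exists_place_at_infinity : ∃ P : Place k C.FunField, 1 < P.val C.x := by
  classical
  have hd : d ≠ 0 := by have := C.two_le; omega
  have hmonic : C.equation.Monic := monic_X_pow_sub_C _ hd
  have hf : algebraMap k[X] (RatFunc k) C.f ≠ 0 := by simpa using C.f_ne_zero
  have hdk : (d : RatFunc k) ≠ 0 := by
    have h := (map_ne_zero (algebraMap k (RatFunc k))).2 C.char_not_dvd
    rwa [map_natCast] at h
  have hsep : C.equation.Separable := separable_X_pow_sub_C _ hdk hf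
  have : FiniteDimensional (RatFunc k) C.FunField := hmonic.finite_adjoinRoot
  have : Algebra.IsSeparable (RatFunc k) C.FunField := by
    have h1 : IsSeparable (RatFunc k) (AdjoinRoot.root C.equation) := by
      rw [IsSeparable, AdjoinRoot.minpoly_root C.irreducible_equation.ne_zero, hmonic.leadingCoeff]
      simpa using hsep
    have h2 := (IntermediateField.isSeparable_adjoin_simple_iff_isSeparable _ _).2 h1
    rw [IntermediateField.adjoin_root_eq_top] at h2
    exact Algebra.IsSeparable.of_algHom _ _
      (IntermediateField.topEquiv (F := RatFunc k) (E := C.FunField)).symm.toAlgHom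
  let v := RatFunc.inftyValuation k
  let A := v.valuationSubring
  have : Nontrivial (MonoidWithZeroHom.valueGroup (.ofClass v)) := inferInstance
  have : IsDiscreteValuationRing A := inferInstance
  let B := integralClosure A C.FunField
  have : IsDedekindDomain B := integralClosure.isDedekindDomain A (RatFunc k) C.FunField
  have : IsFractionRing B C.FunField :=
    integralClosure.isFractionRing_of_finite_extension (RatFunc k) C.FunField
  have hAF : Function.Injective (algebraMap A C.FunField) := by
    rw [IsScalarTower.algebraMap_eq A (RatFunc k) C.FunField]
    exact (algebraMap (RatFunc k) C.FunField).injective.comp Subtype.val_injective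
  have hAB : Function.Injective (algebraMap A B) := by
    intro r s h
    exact hAF (congrArg (algebraMap B C.FunField) h)
  have : FaithfulSMul A B := (faithfulSMul_iff_algebraMap_injective A B).2 hAB
  obtain ⟨P, hPm, hP⟩ := Ideal.exists_maximal_ideal_liesOver_of_isIntegral (S := B)
    (IsLocalRing.maximalIdeal A)
  have hPA : ∀ r : A, v r < 1 → algebraMap A B r ∈ P := by
    intro r hr
    rw [← Ideal.mem_comap, ← Ideal.under_def, ← hP.over]
    exact (v.mem_maximalIdeal_iff).2 hr
  have hX : v (RatFunc.X)⁻¹ < 1 := by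
    rw [map_inv₀, RatFunc.inftyValuation.X, ← exp_neg, ← exp_zero, exp_lt_exp]
    norm_num
  let t : A := ⟨(RatFunc.X)⁻¹, hX.le⟩
  have ht : t ≠ 0 := fun h => inv_ne_zero RatFunc.X_ne_zero (congrArg Subtype.val h)
  have htP : algebraMap A B t ∈ P := hPA t hX
  have hP0 : P ≠ ⊥ := by
    rintro rfl
    exact ht (hAB (by rw [Ideal.mem_bot.1 htP, map_zero]))
  let w : IsDedekindDomain.HeightOneSpectrum B := ⟨P, hPm.isPrime, hP0⟩
  have hle : ∀ r : A, w.valuation C.FunField (algebraMap A C.FunField r) ≤ 1 := fun r =>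
    w.valuation_le_one (algebraMap A B r)
  have hconst : ∀ c : k, c ≠ 0 → w.valuation C.FunField (algebraMap k C.FunField c) ≤ 1 := by
    intro c hc
    have hv : v (RatFunc.C c) = 1 := RatFunc.inftyValuation.C k hc
    exact hle ⟨RatFunc.C c, hv.le⟩
  refine ⟨⟨w.valuation C.FunField, ?_, w.valuation_surjective C.FunField⟩, ?_⟩
  · intro c hc
    refine le_antisymm (hconst c hc) ?_
    have h1 := hconst c⁻¹ (inv_ne_zero hc)
    rwa [map_inv₀, map_inv₀, inv_le_one₀ (zero_lt_iff.2 (by simpa using hc))] at h1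
  · have h1 : w.valuation C.FunField (algebraMap B C.FunField (algebraMap A B t)) < 1 :=
      (w.valuation_lt_one_iff_mem _).2 htP
    have h2 : algebraMap B C.FunField (algebraMap A B t) = C.x⁻¹ :=
      map_inv₀ (AdjoinRoot.of C.equation) RatFunc.X
    have hx : C.x ≠ 0 := (map_ne_zero (AdjoinRoot.of C.equation)).2 RatFunc.X_ne_zero
    rwa [h2, map_inv₀, inv_lt_one₀ (zero_lt_iff.2 (by simpa using hx))] at h1

/-- The pole order of the monomial `c * y ^ i` at infinity, written multiplicatively. -/
noncomputable def weight (n d : ℕ) (c : RatFunc k) (i : ℕ) : ℤᵐ⁰ :=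
  open Classical in if c = 0 then 0 else exp (d * c.intDegree + n * i)

theorem weight_inj {c e : RatFunc k} {i j : ℕ} (hc : c ≠ 0) (hi : i < d) (hj : j < d)
    (h : weight n d c i = weight n d e j) (hnd : n.Coprime d) : i = j := by
  have he : e ≠ 0 := by
    rintro rfl
    simp [weight, hc] at h
  simp only [weight, hc, he, if_false, exp_inj] at h
  have h1 : (d : ℤ) ∣ n * ((i : ℤ) - j) := ⟨e.intDegree - c.intDegree, by linarith⟩
  have h2 : (d : ℤ) ∣ (i : ℤ) - j :=
    (Nat.isCoprime_iff_coprime.2 hnd.symm).dvd_of_dvd_mul_left h1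
  have h3 := Int.eq_zero_of_abs_lt_dvd h2 (by rw [abs_lt]; omega)
  omega

theorem exists_representative (g : C.FunField) :
    ∃ p : (RatFunc k)[X], p.natDegree < d ∧ AdjoinRoot.mk C.equation p = g := by
  have hd : d ≠ 0 := by have := C.two_le; omega
  obtain ⟨p, rfl⟩ := AdjoinRoot.mk_surjective g
  have hmonic : C.equation.Monic := monic_X_pow_sub_C _ hd
  have hdeg : C.equation.natDegree = d := natDegree_X_pow_sub_C
  refine ⟨p %ₘ C.equation, ?_, ?_⟩
  · exact lt_of_lt_of_eq (natDegree_modByMonic_lt p hmonic fun h =>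
      hd (hdeg.symm.trans ((congrArg natDegree h).trans natDegree_one))) hdeg
  · conv_rhs => rw [← modByMonic_add_div p C.equation]
    simp

theorem val_of_place_at_infinity (P : Place k C.FunField) (hP : 1 < P.val C.x) :
    ∀ p : (RatFunc k)[X], p.natDegree < d → ∃ j < d,
      (∀ i < d, weight n d (p.coeff i) i ≤ weight n d (p.coeff j) j) ∧
      P.val (AdjoinRoot.mk C.equation p) = weight n d (p.coeff j) j := by
  have hd : 0 < d := by have := C.two_le; omega
  have hr : ∀ r : RatFunc k, r ≠ 0 → P.val (AdjoinRoot.of C.equation r) = P.val C.x ^ r.intDegree := by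
    intro r hr
    have : (P.val.comap (AdjoinRoot.of C.equation)).IsTrivialOn k := ⟨P.trivial_on_constants⟩
    exact RatFunc.valuation_eq_valuation_X_zpow_intDegree_of_one_lt_valuation_X
      (v := P.val.comap (AdjoinRoot.of C.equation)) hP hr
  have hx0 : P.val C.x ≠ 0 := (zero_lt_one.trans hP).ne'
  have hyd : P.val C.y ^ d = P.val C.x ^ n := by
    have h1 : C.y ^ d = AdjoinRoot.of C.equation (algebraMap k[X] (RatFunc k) C.f) := by
      have h2 := AdjoinRoot.eval₂_root C.equation
      rw [equation, eval₂_sub, eval₂_pow, eval₂_X, eval₂_C, sub_eq_zero] at h2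
      exact h2
    rw [← map_pow, h1, hr _ (by simpa using C.f_ne_zero), RatFunc.intDegree_polynomial,
      C.natDegree_f, zpow_natCast]
  have hy0 : P.val C.y ≠ 0 := by
    intro h
    rw [h, zero_pow hd.ne'] at hyd
    exact pow_ne_zero _ hx0 hyd.symm
  obtain ⟨t, ht, htx, hty⟩ : ∃ t : ℕ, 0 < t ∧ P.val C.x = exp ((d : ℤ) * t) ∧
      P.val C.y = exp ((n : ℤ) * t) := by
    have h1 : (d : ℤ) * log (P.val C.y) = n * log (P.val C.x) := by
      have := congrArg log hyd
      simpa [log_pow] using this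
    have h2 : 0 < log (P.val C.x) := by
      rw [← log_one]
      exact (log_lt_log one_ne_zero hx0).2 hP
    obtain ⟨s, hs⟩ : (d : ℤ) ∣ log (P.val C.x) :=
      (Nat.isCoprime_iff_coprime.2 C.coprime.symm).dvd_of_dvd_mul_left ⟨_, h1.symm⟩
    have hd' : (0 : ℤ) < d := by exact_mod_cast hd
    have hs0 : 0 < s := by
      rw [hs] at h2
      exact (mul_pos_iff_of_pos_left hd').1 h2
    obtain ⟨t, rfl⟩ := Int.eq_ofNat_of_zero_le hs0.le
    refine ⟨t, by exact_mod_cast hs0, ?_, ?_⟩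
    · rw [← hs, exp_log hx0]
    · have : log (P.val C.y) = n * t := by
        rw [hs] at h1
        exact mul_left_cancel₀ hd'.ne' (by linarith)
      rw [← this, exp_log hy0]
  have hterm : ∀ (c : RatFunc k) (i : ℕ),
      P.val (AdjoinRoot.of C.equation c * C.y ^ i) = weight n d c i ^ t := by
    intro c i
    by_cases hc : c = 0
    · simp [hc, weight, ht.ne']
    · rw [map_mul, map_pow, hr c hc, htx, hty]
      simp only [weight, hc, if_false]
      rw [← exp_zsmul, ← exp_nsmul, ← exp_nsmul, ← exp_add]
      congr 1
      simp
      ring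
  have key : ∀ p : (RatFunc k)[X], p.natDegree < d → ∃ j < d,
      (∀ i < d, weight n d (p.coeff i) i ≤ weight n d (p.coeff j) j) ∧
      P.val (AdjoinRoot.mk C.equation p) = weight n d (p.coeff j) j ^ t := by
    intro p hp
    obtain ⟨j, hj, hmax⟩ := Finset.exists_max_image (Finset.range d)
      (fun i => weight n d (p.coeff i) i) ⟨0, Finset.mem_range.2 hd⟩
    have hsum : AdjoinRoot.mk C.equation p =
        ∑ i ∈ Finset.range d, AdjoinRoot.of C.equation (p.coeff i) * C.y ^ i := by
      conv_lhs => rw [p.as_sum_range_C_mul_X_pow' hp]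
      simp [y]
    refine ⟨j, Finset.mem_range.1 hj, fun i hi => hmax i (Finset.mem_range.2 hi), ?_⟩
    rw [hsum]
    by_cases h0 : p.coeff j = 0
    · have hz : ∀ i ∈ Finset.range d, p.coeff i = 0 := by
        intro i hi
        by_contra hne
        have := hmax i hi
        simp [weight, h0, hne] at this
      rw [Finset.sum_eq_zero (fun i hi => by rw [hz i hi, map_zero, zero_mul])]
      simp [h0, weight, ht.ne']
    · rw [← hterm]
      refine Valuation.map_sum_eq_of_lt _ hj fun i hi => ?_
      obtain ⟨hi, hij⟩ := Finset.mem_sdiff.1 hi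
      rw [hterm, hterm]
      refine pow_lt_pow_left₀ (lt_of_le_of_ne (hmax i hi) fun h => hij ?_) zero_le ht.ne'
      exact Finset.mem_singleton.2 (weight_inj h0 (Finset.mem_range.1 hj) (Finset.mem_range.1 hi) h.symm C.coprime).symm
  have ht1 : t = 1 := by
    obtain ⟨g, hg⟩ := P.surjective (exp 1)
    obtain ⟨p, hp, rfl⟩ := C.exists_representative g
    obtain ⟨j, -, -, hj⟩ := key p hp
    have h1 : (t : ℤ) * log (weight n d (p.coeff j) j) = 1 := by
      have := congrArg log (hj.symm.trans hg)
      simpa [log_pow] using this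
    exact_mod_cast Int.eq_one_of_mul_eq_one_right (Int.natCast_nonneg t) h1
  simpa [ht1] using key

theorem existsUnique_place_at_infinity : ∃! P : Place k C.FunField, 1 < P.val C.x := by
  obtain ⟨P, hP⟩ := C.exists_place_at_infinity
  refine ⟨P, hP, fun Q hQ => Place.ext (Valuation.ext fun g => ?_)⟩
  obtain ⟨p, hp, rfl⟩ := C.exists_representative g
  obtain ⟨i, hi, himax, h1⟩ := C.val_of_place_at_infinity P hP p hp
  obtain ⟨j, hj, hjmax, h2⟩ := C.val_of_place_at_infinity Q hQ p hp
  rw [h1, h2]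
  exact le_antisymm (himax j hj) (hjmax i hi)

/-- The point `O` of the curve at infinity: the only point where `x` has a pole. -/
noncomputable def infinity : Place k C.FunField := C.existsUnique_place_at_infinity.choose

/-- `P` is the point `(a, c)` of the affine curve: the coordinate functions `x` and `y` are regular
at `P`, with values `a` and `c`. -/
def HasCoords (P : Place k C.FunField) (a c : k) : Prop :=
  P.TakesValue C.x a ∧ P.TakesValue C.y c

/-- The order of the point `P` in the group of points of the Jacobian, the curve being embedded in
its Jacobian with `O` as base point. By convention it is `0` if `P` is not a torsion point. -/
noncomputable def orderInJacobian [IsAlgClosed k] (P : Place k C.FunField) : ℕ :=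
  addOrderOf (abelJacobi C.infinity P)

section Rationality

variable {K : Type*} [Field K] [Algebra k K]

/-- The `K`-point `P` of the curve is a `k`-point: each function on the curve that is defined over
`k` and regular at `P` takes a value in `k` there. -/
def IsRational (P : Place K (C.baseChange K).FunField) : Prop :=
  ∀ g : C.FunField, P.val (C.funBaseChange K g) ≤ 1 →
    ∃ c : k, P.TakesValue (C.funBaseChange K g) (algebraMap k K c)

end Rationality

/-- The equality `f(x) = -B ^ d * (x - a) ^ m₀ + v(x) ^ d`, where `v` is a polynomial of degree `ℓ₀`
with nonzero leading coefficient `B` and with `v(a) ≠ 0`. -/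
def IsDecomposition (ℓ₀ m₀ : ℕ) (a B : k) (v : k[X]) : Prop :=
  B ≠ 0 ∧ v.natDegree = ℓ₀ ∧ v.leadingCoeff = B ∧ v.eval a ≠ 0 ∧
    C.f = -Polynomial.C (B ^ d) * (X - Polynomial.C a) ^ m₀ + v ^ d

/-- An isomorphism, defined over `k`, of the smooth projective models of two curves, viewed as
curves over the extension field `K`: a bijection between the points, such that composition with it
is an isomorphism of the fields of rational functions, which preserves the orders of zeros and
poles and identifies the functions defined over `k`. -/
structure Iso (C C' : CyclicCover k n d) (K : Type*) [Field K] [Algebra k K] where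
  onPoints : Place K (C.baseChange K).FunField ≃ Place K (C'.baseChange K).FunField
  pullback : (C'.baseChange K).FunField ≃ₐ[K] (C.baseChange K).FunField
  pullbackBase : C'.FunField ≃ₐ[k] C.FunField
  val_onPoints : ∀ P g, (onPoints P).val g = P.val (pullback g)
  pullback_base : ∀ g, pullback (C'.funBaseChange K g) = C.funBaseChange K (pullbackBase g)

end CyclicCover

/-! ### Values of functions with respect to a valuation trivial on the constants -/

section

variable {k F : Type*} [Field k] [Field F] [Algebra k F] {w : Valuation F ℤᵐ⁰}

/-! At the point O at infinity, x and y have poles of orders d and n. Since n and d are coprime, the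
monomials x^j y^i with i < d have distinct pole orders, so the pole order of a polynomial in x and y
is read off without cancellation (`val_infinity`). A function regular away from O is such a
polynomial (`exists_aevalAeval_of_regular`). The number m₀ is the multiple of d strictly between n
and n + d (`lt_mul_floor`).

Let P have order m₀ and let g have divisor m₀(P) - m₀(O). As m₀ < n + d < 2n, g = p(x) + e y with e
constant and deg p = ℓ₀. If e = 0, then p is a constant times a power of x - a, so d(P) - d(O) is
already principal, which is absurd since d < m₀. So g may be taken to be y - v(x). A root c of v^d -
f gives the point (c, v(c)), a zero of g, so c = a and v^d - f = B^d (x - a)^m₀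
(`isDecomposition_of_divisor`). This takes place over K. To descend, v(a) = y(P) is in K₀, and v is
a d-th root of f modulo (x - a)^m₀ with this value at a; as d is invertible, its coefficients are
computed inside K₀ (`mem_lifts_of_pow`), without any Galois action.

Conversely, y - v divides y^d - v^d = -B^d (x - a)^m₀, so its only affine zero is P = (a, v(a)).
There x - a is a local parameter (`HasCoords.val_x_sub`) and the cofactor has the value d v(a)^(d-1)
≠ 0, so m₀ kills P. A smaller order would be at most m₀/2 < n; but a function with its only pole at
O, of order less than n, is a polynomial in x, which vanishes with P at all its conjugates (a, ζ
y(P)) (`nsmul_ne_zero_of_lt`).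

Finally, q is the factor v - u of f = v^d - u^d, where u = B (x - a)^ℓ₀, and the cofactor has degree
ℓ₀(d - 1) (`exists_mul_geom_sum`). Part (2) is a linear change of coordinates, after which the
criterion of (1) applies again. -/

theorem Valuation.map_algebraMap_le_one (hw : ∀ c : k, c ≠ 0 → w (algebraMap k F c) = 1) (c : k) :
    w (algebraMap k F c) ≤ 1 := by
  by_cases hc : c = 0
  · simp [hc]
  · exact (hw c hc).le

theorem Valuation.map_le_one_of_sub_lt (hw : ∀ c : k, c ≠ 0 → w (algebraMap k F c) = 1)
    {g : F} {c : k}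
    (h : w (g - algebraMap k F c) < 1) : w g ≤ 1 := by
  have := w.map_add_le h.le (Valuation.map_algebraMap_le_one hw c)
  rwa [sub_add_cancel] at this

theorem Valuation.map_eq_one_of_sub_lt (hw : ∀ c : k, c ≠ 0 → w (algebraMap k F c) = 1)
    {g : F} {c : k}
    (hc : c ≠ 0) (h : w (g - algebraMap k F c) < 1) : w g = 1 := by
  have h1 := w.map_add_eq_of_lt_right (x := g - algebraMap k F c) (y := algebraMap k F c)
    (by rwa [hw c hc])
  rwa [sub_add_cancel, hw c hc] at h1

theorem Valuation.value_unique (hw : ∀ c : k, c ≠ 0 → w (algebraMap k F c) = 1) {g : F} {c e : k}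
    (hc : w (g - algebraMap k F c) < 1) (he : w (g - algebraMap k F e) < 1) : c = e := by
  by_contra hne
  have h1 := w.map_sub_lt he hc
  rw [sub_sub_sub_cancel_left, ← _root_.map_sub, hw _ (sub_ne_zero.2 hne)] at h1
  exact lt_irrefl _ h1

theorem Valuation.aevalAeval_le_one (hw : ∀ c : k, c ≠ 0 → w (algebraMap k F c) = 1) {x y : F}
    (hx : w x ≤ 1) (hy : w y ≤ 1) (A : k[X][X]) : w (aevalAeval x y A) ≤ 1 := by
  have h1 : ∀ p : k[X], w (aeval x p) ≤ 1 := by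
    intro p
    rw [aeval_eq_sum_range]
    refine w.map_sum_le fun i _ => ?_
    rw [Algebra.smul_def, map_mul, map_pow]
    exact mul_le_one' (Valuation.map_algebraMap_le_one hw _) (pow_le_one' hx i)
  induction A using Polynomial.induction_on' with
  | add p q hp hq => rw [map_add]; exact w.map_add_le hp hq
  | monomial n p =>
    rw [← C_mul_X_pow_eq_monomial, map_mul, map_pow, map_mul, map_pow]
    refine mul_le_one' ?_ (pow_le_one' ?_ n)
    · simpa using h1 p
    · simpa using hy

theorem Valuation.aeval_le_one (hw : ∀ c : k, c ≠ 0 → w (algebraMap k F c) = 1) {x : F}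
    (hx : w x ≤ 1) (p : k[X]) : w (aeval x p) ≤ 1 := by
  simpa using Valuation.aevalAeval_le_one hw hx (y := 0) (by simp) (C p)

theorem Valuation.aeval_sub_lt (hw : ∀ c : k, c ≠ 0 → w (algebraMap k F c) = 1) {x : F} {a : k}
    (hx : w (x - algebraMap k F a) < 1) (p : k[X]) :
    w (aeval x p - algebraMap k F (p.eval a)) < 1 := by
  obtain ⟨q, hq⟩ := X_sub_C_dvd_sub_C_eval (a := a) (p := p)
  have h := congrArg (aeval x) hq
  simp only [_root_.map_sub, map_mul, aeval_C, aeval_X] at h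
  rw [h, map_mul]
  exact mul_lt_one_of_lt_of_le hx (Valuation.aeval_le_one hw (Valuation.map_le_one_of_sub_lt hw hx) q)

theorem Valuation.aevalAeval_sub_lt (hw : ∀ c : k, c ≠ 0 → w (algebraMap k F c) = 1)
    {x y : F} {a b : k}
    (hx : w (x - algebraMap k F a) < 1) (hy : w (y - algebraMap k F b) < 1) (A : k[X][X]) :
    w (aevalAeval x y A - algebraMap k F (A.evalEval a b)) < 1 := by
  obtain ⟨q, hq⟩ := X_sub_C_dvd_sub_C_eval (a := Polynomial.C b) (p := A)
  have h := congrArg (aevalAeval x y) hq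
  have e1 : aevalAeval x y (X - Polynomial.C (Polynomial.C b)) = y - algebraMap k F b := by simp
  have e2 : aevalAeval x y (Polynomial.C (A.eval (Polynomial.C b))) =
    aeval x (A.eval (Polynomial.C b)) := by simp
  rw [map_mul, _root_.map_sub, e1, e2] at h
  have h3 : aevalAeval x y A - algebraMap k F (A.evalEval a b) =
      (y - algebraMap k F b) * aevalAeval x y q + (aeval x (A.eval (Polynomial.C b)) -
        algebraMap k F ((A.eval (Polynomial.C b)).eval a)) := by
    rw [← h, evalEval]; ring
  rw [h3]
  refine w.map_add_lt ?_ (Valuation.aeval_sub_lt hw hx _)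
  rw [map_mul]
  exact mul_lt_one_of_lt_of_le hy
    (Valuation.aevalAeval_le_one hw (Valuation.map_le_one_of_sub_lt hw hx)
      (Valuation.map_le_one_of_sub_lt hw hy) q)

end

namespace CyclicCover

variable {k : Type*} [Field k] {n d : ℕ} (C : CyclicCover k n d)

/-! ### The function field -/

theorem d_pos (C : CyclicCover k n d) : 0 < d := zero_lt_two.trans_le C.two_le

theorem of_algebraMap (p : k[X]) :
    AdjoinRoot.of C.equation (algebraMap k[X] (RatFunc k) p) = aeval C.x p := by
  have h : ((AdjoinRoot.of C.equation).comp (algebraMap k[X] (RatFunc k))) =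
      (aeval (R := k) C.x : k[X] →ₐ[k] C.FunField).toRingHom := by
    refine Polynomial.ringHom_ext (fun c => ?_) ?_
    · simp only [RingHom.comp_apply, AlgHom.toRingHom_eq_coe, RingHom.coe_coe, aeval_C]
      rw [IsScalarTower.algebraMap_apply k (RatFunc k) C.FunField,
        IsScalarTower.algebraMap_apply k k[X] (RatFunc k)]
      rfl
    · simp [x]
  exact RingHom.congr_fun h p

theorem y_pow : C.y ^ d = aeval C.x C.f := by
  have h := AdjoinRoot.eval₂_root C.equation
  rw [equation, eval₂_sub, eval₂_pow, eval₂_X, eval₂_C, sub_eq_zero] at h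
  rw [← of_algebraMap]
  exact h

theorem aeval_x_injective : Function.Injective (aeval (R := k) C.x) := by
  intro p q h
  rw [← of_algebraMap, ← of_algebraMap] at h
  exact IsFractionRing.injective k[X] (RatFunc k) ((AdjoinRoot.of C.equation).injective h)

theorem aeval_x_ne_zero {p : k[X]} (hp : p ≠ 0) : aeval C.x p ≠ 0 := fun h =>
  hp (C.aeval_x_injective (h.trans (map_zero _).symm))

theorem aevalAeval_map (A : k[X][X]) :
    AdjoinRoot.mk C.equation (A.map (algebraMap k[X] (RatFunc k))) = aevalAeval C.x C.y A := by
  induction A using Polynomial.induction_on' with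
  | add p q hp hq => rw [Polynomial.map_add, map_add, map_add, hp, hq]
  | monomial n p =>
    rw [← C_mul_X_pow_eq_monomial]
    simp only [Polynomial.map_mul, Polynomial.map_pow, map_C, map_X, map_mul, map_pow,
      AdjoinRoot.mk_C, AdjoinRoot.mk_X, of_algebraMap]
    simp [y]

/-- Clearing denominators in k(x)[Y] reduces questions on rational functions to polynomials in x and
y. -/
theorem exists_fraction (g : C.FunField) : ∃ (A : k[X][X]) (D : k[X]), D ≠ 0 ∧
    aeval C.x D * g = aevalAeval C.x C.y A := by
  obtain ⟨p, rfl⟩ := AdjoinRoot.mk_surjective g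
  obtain ⟨D, hD, h⟩ := IsLocalization.integerNormalization_spec (nonZeroDivisors k[X]) p
  refine ⟨IsLocalization.integerNormalization (nonZeroDivisors k[X]) p, D,
    nonZeroDivisors.ne_zero hD, ?_⟩
  rw [← aevalAeval_map, h, ← of_algebraMap]
  rw [← IsScalarTower.algebraMap_smul (RatFunc k) D p,
    Polynomial.smul_eq_C_mul, map_mul, AdjoinRoot.mk_C]

/-- Homomorphisms out of the function field are determined by their values on constants, `x`
and `y`. -/
theorem funField_hom_ext {L : Type*} [Field L] {φ ψ : C.FunField →+* L}
    (hc : ∀ c : k, φ (algebraMap k C.FunField c) = ψ (algebraMap k C.FunField c))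
    (hx : φ C.x = ψ C.x) (hy : φ C.y = ψ C.y) : φ = ψ := by
  have h1 : ∀ p : k[X], φ (aeval C.x p) = ψ (aeval C.x p) := by
    intro p
    simp only [aeval_eq_sum_range, map_sum, Algebra.smul_def, map_mul, map_pow, hc, hx]
  have h2 : ∀ A : k[X][X], φ (aevalAeval C.x C.y A) = ψ (aevalAeval C.x C.y A) := by
    intro A
    induction A using Polynomial.induction_on' with
    | add p q hp hq => simp only [map_add, hp, hq]
    | monomial n p =>
      rw [← C_mul_X_pow_eq_monomial]
      simp [hy, h1]
  refine RingHom.ext fun g => ?_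
  obtain ⟨A, D, hD, h⟩ := C.exists_fraction g
  have h3 := h2 A
  rw [← h, map_mul, map_mul, h1 D] at h3
  exact mul_left_cancel₀ ((map_ne_zero ψ).2 (C.aeval_x_ne_zero hD)) h3

theorem funField_algHom_ext {L : Type*} [Field L] [Algebra k L] {φ ψ : C.FunField →ₐ[k] L}
    (hx : φ C.x = ψ C.x) (hy : φ C.y = ψ C.y) : φ = ψ :=
  AlgHom.coe_ringHom_injective (C.funField_hom_ext (by simp) hx hy)

/-! ### Changes of coordinates -/

variable {C} {C' : CyclicCover k n d}

theorem aeval_shift_injective (a : k) :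
    Function.Injective (aeval (R := k) (C.x - algebraMap k C.FunField a)) := by
  intro p q h
  have h1 : ∀ p : k[X], aeval (C.x - algebraMap k C.FunField a) p =
      aeval C.x (p.comp (X - Polynomial.C a)) := by
    intro p
    simp [aeval_comp]
  rw [h1, h1] at h
  have h2 := congrArg (fun r => comp r (X + Polynomial.C a)) (C.aeval_x_injective h)
  simpa [comp_assoc] using h2

/-- The homomorphism of function fields that sends `x` to `x - a` and `y` to `b⁻¹ y`. -/
noncomputable def substHom (a b : k)
    (h : C'.f = Polynomial.C (b ^ d)⁻¹ * C.f.comp (X + Polynomial.C a)) :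
    C'.FunField →ₐ[k] C.FunField :=
  AdjoinRoot.liftAlgHom _
    (RatFunc.liftAlgHom (aeval (C.x - algebraMap k C.FunField a))
      (nonZeroDivisors_le_comap_nonZeroDivisors_of_injective _ (aeval_shift_injective a)))
    (algebraMap k C.FunField b⁻¹ * C.y) (by
      have h1 := RatFunc.liftAlgHom_apply_div (aeval (C.x - algebraMap k C.FunField a))
        (nonZeroDivisors_le_comap_nonZeroDivisors_of_injective _ (aeval_shift_injective a)) C'.f 1
      simp only [map_one, div_one] at h1
      simp only [equation, eval₂_sub, eval₂_pow, eval₂_X, eval₂_C]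
      erw [h1]
      rw [mul_pow, y_pow, h]
      simp [aeval_comp])

theorem substHom_x (a b : k)
    (h : C'.f = Polynomial.C (b ^ d)⁻¹ * C.f.comp (X + Polynomial.C a)) :
    substHom a b h C'.x = C.x - algebraMap k C.FunField a := by
  have h1 := RatFunc.liftAlgHom_apply_div (aeval (C.x - algebraMap k C.FunField a))
    (nonZeroDivisors_le_comap_nonZeroDivisors_of_injective _ (aeval_shift_injective a)) X 1
  simp only [map_one, div_one, aeval_X, RatFunc.algebraMap_X] at h1
  exact (AdjoinRoot.liftAlgHom_of ..).trans h1

theorem substHom_y (a b : k)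
    (h : C'.f = Polynomial.C (b ^ d)⁻¹ * C.f.comp (X + Polynomial.C a)) :
    substHom a b h C'.y = algebraMap k C.FunField b⁻¹ * C.y :=
  AdjoinRoot.liftAlgHom_root ..

theorem subst_symm {a b : k} (hb : b ≠ 0)
    (h : C'.f = Polynomial.C (b ^ d)⁻¹ * C.f.comp (X + Polynomial.C a)) :
    C.f = Polynomial.C (b⁻¹ ^ d)⁻¹ * C'.f.comp (X + Polynomial.C (-a)) := by
  rw [h, mul_comp, comp_assoc, C_comp, ← mul_assoc, ← Polynomial.C_mul, inv_pow, inv_inv,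
    mul_inv_cancel₀ (pow_ne_zero _ hb)]
  simp

/-- The isomorphism of function fields that sends `x` to `x - a` and `y` to `b⁻¹ y`. -/
noncomputable def substEquiv (a : k) {b : k} (hb : b ≠ 0)
    (h : C'.f = Polynomial.C (b ^ d)⁻¹ * C.f.comp (X + Polynomial.C a)) :
    C'.FunField ≃ₐ[k] C.FunField :=
  AlgEquiv.ofAlgHom (substHom a b h) (substHom (-a) b⁻¹ (subst_symm hb h))
    (funField_algHom_ext C (by simp [substHom_x]) (by
      simp only [AlgHom.comp_apply, substHom_y, map_mul, AlgHom.commutes, AlgHom.id_apply,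
        ← mul_assoc, inv_inv]
      rw [← map_mul, mul_inv_cancel₀ hb]
      simp))
    (funField_algHom_ext C' (by simp [substHom_x]) (by
      simp only [AlgHom.comp_apply, substHom_y, map_mul, AlgHom.commutes, AlgHom.id_apply,
        ← mul_assoc, inv_inv]
      rw [← map_mul, inv_mul_cancel₀ hb]
      simp))

theorem substEquiv_x (a : k) {b : k} (hb : b ≠ 0)
    (h : C'.f = Polynomial.C (b ^ d)⁻¹ * C.f.comp (X + Polynomial.C a)) :
    substEquiv a hb h C'.x = C.x - algebraMap k C.FunField a := substHom_x a b h

theorem substEquiv_y (a : k) {b : k} (hb : b ≠ 0)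
    (h : C'.f = Polynomial.C (b ^ d)⁻¹ * C.f.comp (X + Polynomial.C a)) :
    substEquiv a hb h C'.y = algebraMap k C.FunField b⁻¹ * C.y := substHom_y a b h

end CyclicCover

/-- Transport of a point along an isomorphism of function fields. -/
noncomputable def Place.comap {k F F' : Type*} [Field k] [Field F] [Algebra k F] [Field F']
    [Algebra k F'] (P : Place k F) (e : F' ≃ₐ[k] F) : Place k F' where
  val := P.val.comap (e : F' →+* F)
  trivial_on_constants c hc := by
    simpa using P.trivial_on_constants c hc
  surjective := P.surjective.comp e.surjective

theorem Place.comap_val {k F F' : Type*} [Field k] [Field F] [Algebra k F] [Field F']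
    [Algebra k F'] (P : Place k F) (e : F' ≃ₐ[k] F) (g : F') : (P.comap e).val g = P.val (e g) :=
  rfl

namespace CyclicCover

variable {k : Type*} [Field k] {n d : ℕ} (C : CyclicCover k n d)

/-! ### The local ring of a point with nonzero second coordinate -/

theorem x_sub_ne_zero (a : k) : C.x - algebraMap k C.FunField a ≠ 0 := by
  have h := C.aeval_x_ne_zero (X_sub_C_ne_zero a)
  simpa using h

/-- A function that vanishes at the point `(a, b)`, `b ≠ 0`, is divisible by `x - a` in the local
ring of this point. -/
theorem exists_mul_eq_of_evalEval_eq_zero {a b : k} (hb : b ≠ 0) (hab : b ^ d = C.f.eval a)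
    {A : k[X][X]} (hA : A.evalEval a b = 0) : ∃ S A' : k[X][X], S.evalEval a b ≠ 0 ∧
      aevalAeval C.x C.y S * aevalAeval C.x C.y A =
        (C.x - algebraMap k C.FunField a) * aevalAeval C.x C.y A' := by
  obtain ⟨A₂, hA₂⟩ := X_sub_C_dvd_sub_C_eval (a := Polynomial.C b) (p := A)
  obtain ⟨A₁, hA₁⟩ := dvd_iff_isRoot.2 (show IsRoot (A.eval (Polynomial.C b)) a from hA)
  obtain ⟨T, hT⟩ := X_sub_C_dvd_sub_C_eval (a := a) (p := C.f)
  -- S is (Y^d - b^d)/(Y - b). On the curve S · (y - b) = f(x) - f(a) is divisible by x - a, while S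
  -- takes the value d b^(d-1) ≠ 0 at (a, b).
  let S : k[X][X] := ∑ i ∈ Finset.range d, X ^ i * Polynomial.C (Polynomial.C b) ^ (d - 1 - i)
  have hS : S * (X - Polynomial.C (Polynomial.C b)) =
      X ^ d - Polynomial.C (Polynomial.C b) ^ d := (Commute.all _ _).geom_sum₂_mul d
  refine ⟨S, S * Polynomial.C A₁ + Polynomial.C T * A₂, ?_, ?_⟩
  · have h : S.evalEval a b = d * b ^ (d - 1) := by
      simp only [S, evalEval_finsetSum, evalEval_mul, evalEval_pow, evalEval_X, evalEval_C, eval_C]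
      rw [Finset.sum_congr rfl fun i hi => by
        rw [← pow_add, show i + (d - 1 - i) = d - 1 by have := Finset.mem_range.1 hi; omega]]
      simp
    rw [h]
    exact mul_ne_zero C.char_not_dvd (pow_ne_zero _ hb)
  · have e1 : aevalAeval C.x C.y S * (C.y - algebraMap k C.FunField b) =
        (C.x - algebraMap k C.FunField a) * aeval C.x T := by
      have h1 := congrArg (aevalAeval C.x C.y) hS
      have h2 := congrArg (aeval C.x) hT
      simp only [map_sub, map_mul, map_pow, aevalAeval_C, aevalAeval_Y, aeval_C, aeval_X] at h1 h2
      rw [h1, y_pow, ← h2, ← hab, map_pow]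
    have e2 : aevalAeval C.x C.y A = (C.y - algebraMap k C.FunField b) * aevalAeval C.x C.y A₂ +
        (C.x - algebraMap k C.FunField a) * aeval C.x A₁ := by
      have h1 := congrArg (aevalAeval C.x C.y) (sub_eq_iff_eq_add.1 hA₂)
      rw [hA₁] at h1
      simpa only [map_sub, map_add, map_mul, aevalAeval_C, aevalAeval_Y, aeval_C, aeval_X] using h1
    rw [e2]
    simp only [map_add, map_mul, aevalAeval_C]
    linear_combination (aevalAeval C.x C.y A₂) * e1

/-- Powers of x - a are split off as long as the remaining factor vanishes at (a, b). Each one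
raises the order by at least 1, because the values lie in ℤ, so a lower bound `exp (-N)` for the
valuation bounds the number of steps. Surjectivity of `w` is not required, so that restrictions of
places to a smaller function field are allowed. -/
theorem exists_order_of_aevalAeval {w : Valuation C.FunField ℤᵐ⁰}
    (hw : ∀ c : k, c ≠ 0 → w (algebraMap k C.FunField c) = 1) {a b : k} (hb : b ≠ 0)
    (hab : b ^ d = C.f.eval a)
    (hx : w (C.x - algebraMap k C.FunField a) < 1) (hy : w (C.y - algebraMap k C.FunField b) < 1)
    {A : k[X][X]} (hA : aevalAeval C.x C.y A ≠ 0) :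
    ∃ (m : ℕ) (S A' : k[X][X]), S.evalEval a b ≠ 0 ∧ A'.evalEval a b ≠ 0 ∧
      aevalAeval C.x C.y S * aevalAeval C.x C.y A =
        (C.x - algebraMap k C.FunField a) ^ m * aevalAeval C.x C.y A' := by
  have hlt : ∀ z : ℤᵐ⁰, z ≠ 0 → z < 1 → z ≤ exp (-1) := by
    intro z hz h
    rw [← exp_log hz, ← exp_zero, exp_lt_exp] at h
    rw [← exp_log hz, exp_le_exp]
    omega
  have key : ∀ (N : ℕ) (A : k[X][X]), aevalAeval C.x C.y A ≠ 0 →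
      exp (-(N : ℤ)) ≤ w (aevalAeval C.x C.y A) →
      ∃ (m : ℕ) (S A' : k[X][X]), S.evalEval a b ≠ 0 ∧ A'.evalEval a b ≠ 0 ∧
      aevalAeval C.x C.y S * aevalAeval C.x C.y A =
        (C.x - algebraMap k C.FunField a) ^ m * aevalAeval C.x C.y A' := by
    intro N
    induction N with
    | zero =>
      intro A _ hN
      refine ⟨0, 1, A, by simp, fun h0 => ?_, by simp⟩
      have h1 := Valuation.aevalAeval_sub_lt hw hx hy A
      rw [h0, map_zero, sub_zero] at h1
      exact absurd hN (not_le.2 (by simpa using h1))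
    | succ N ih =>
      intro A hA hN
      by_cases h0 : A.evalEval a b = 0
      · obtain ⟨S, A₁, hS, h1⟩ := C.exists_mul_eq_of_evalEval_eq_zero hb hab h0
        have hwS := Valuation.map_eq_one_of_sub_lt hw hS (Valuation.aevalAeval_sub_lt hw hx hy S)
        have hS0 : aevalAeval C.x C.y S ≠ 0 := by
          intro h
          simp [h] at hwS
        have hA₁ : aevalAeval C.x C.y A₁ ≠ 0 := by
          intro h
          rw [h, mul_zero] at h1
          exact mul_ne_zero hS0 hA h1
        obtain ⟨m, S', A', hS', hA', h2⟩ := ih A₁ hA₁ (by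
          have h3 := congrArg w h1
          rw [map_mul, map_mul, hwS, one_mul] at h3
          have h4 : exp (-((N + 1 : ℕ) : ℤ)) ≤ exp (-1) * w (aevalAeval C.x C.y A₁) :=
            (hN.trans h3.le).trans
              (mul_le_mul_left (hlt _ (w.ne_zero_iff.2 (C.x_sub_ne_zero a)) hx) _)
          rw [show (-((N + 1 : ℕ) : ℤ)) = -1 + -(N : ℤ) by push_cast; ring, exp_add] at h4
          exact le_of_mul_le_mul_left h4 (zero_lt_iff.2 exp_ne_zero))
        refine ⟨m + 1, S' * S, A', by rw [evalEval_mul]; exact mul_ne_zero hS' hS, hA', ?_⟩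
        rw [map_mul, mul_assoc, h1, pow_succ']
        linear_combination (C.x - algebraMap k C.FunField a) * h2
      · exact ⟨0, 1, A, by simp, h0, by simp⟩
  have hwA := w.ne_zero_iff.2 hA
  refine key (log (w (aevalAeval C.x C.y A))).natAbs A hA ?_
  conv_rhs => rw [← exp_log hwA]
  rw [exp_le_exp]
  omega

/-- Each nonzero rational function is, for some `m`, the product of `(x - a) ^ m` and of a
function that is regular at `(a, b)` and takes there a nonzero value. -/
theorem exists_order {w₀ : Valuation C.FunField ℤᵐ⁰}
    (hw₀ : ∀ c : k, c ≠ 0 → w₀ (algebraMap k C.FunField c) = 1) {a b : k} (hb : b ≠ 0)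
    (hab : b ^ d = C.f.eval a)
    (hx₀ : w₀ (C.x - algebraMap k C.FunField a) < 1)
    (hy₀ : w₀ (C.y - algebraMap k C.FunField b) < 1) {g : C.FunField} (hg : g ≠ 0) :
    ∃ (m : ℤ) (c : k) (u : C.FunField), c ≠ 0 ∧
      g = (C.x - algebraMap k C.FunField a) ^ m * u ∧
      ∀ w : Valuation C.FunField ℤᵐ⁰, (∀ c : k, c ≠ 0 → w (algebraMap k C.FunField c) = 1) →
        w (C.x - algebraMap k C.FunField a) < 1 → w (C.y - algebraMap k C.FunField b) < 1 →
        w (u - algebraMap k C.FunField c) < 1 := by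
  obtain ⟨A, D, hD, h⟩ := C.exists_fraction g
  have hD' := C.aeval_x_ne_zero hD
  have hA : aevalAeval C.x C.y A ≠ 0 := h ▸ mul_ne_zero hD' hg
  obtain ⟨m₁, S₁, A₁, hS₁, hA₁, h1⟩ := C.exists_order_of_aevalAeval hw₀ hb hab hx₀ hy₀ hA
  obtain ⟨m₂, S₂, A₂, hS₂, hA₂, h2⟩ := C.exists_order_of_aevalAeval hw₀ hb hab hx₀ hy₀
    (A := Polynomial.C D) (by rwa [aevalAeval_C])
  rw [aevalAeval_C] at h2
  have hne : ∀ S : k[X][X], S.evalEval a b ≠ 0 → aevalAeval C.x C.y S ≠ 0 := by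
    intro S hS h0
    have h3 := Valuation.map_eq_one_of_sub_lt hw₀ hS (Valuation.aevalAeval_sub_lt hw₀ hx₀ hy₀ S)
    simp [h0] at h3
  -- Numerator and denominator of the unit are polynomials that are nonzero at (a, b). The
  -- factorization is thus valid for every valuation centred there, not only for `w₀`, which makes
  -- it possible to compare two of them.
  refine ⟨m₁ - m₂, (A₁ * S₂).evalEval a b / (S₁ * A₂).evalEval a b,
    aevalAeval C.x C.y (A₁ * S₂) / aevalAeval C.x C.y (S₁ * A₂), ?_, ?_, ?_⟩
  · simp [evalEval_mul, hA₁, hS₂, hS₁, hA₂]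
  · have h3 := C.x_sub_ne_zero a
    rw [zpow_sub₀ h3, zpow_natCast, zpow_natCast, map_mul, map_mul, div_mul_div_comm,
      eq_div_iff (mul_ne_zero (pow_ne_zero _ h3) (mul_ne_zero (hne _ hS₁) (hne _ hA₂)))]
    apply mul_left_cancel₀ hD'
    linear_combination (aeval C.x D) * g * (aevalAeval C.x C.y S₁) * (-h2) +
      (aevalAeval C.x C.y S₁) * (aevalAeval C.x C.y S₂ * aeval C.x D) * h +
      (aevalAeval C.x C.y S₂ * aeval C.x D) * h1
  · intro w hw hx hy
    have hE : (S₁ * A₂).evalEval a b ≠ 0 := by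
      rw [evalEval_mul]; exact mul_ne_zero hS₁ hA₂
    have hN := Valuation.aevalAeval_sub_lt hw hx hy (A₁ * S₂)
    have hM := Valuation.aevalAeval_sub_lt hw hx hy (S₁ * A₂)
    have hM1 := Valuation.map_eq_one_of_sub_lt hw hE hM
    have h3 : aevalAeval C.x C.y (A₁ * S₂) / aevalAeval C.x C.y (S₁ * A₂) -
        algebraMap k C.FunField ((A₁ * S₂).evalEval a b / (S₁ * A₂).evalEval a b) =
        (aevalAeval C.x C.y (S₁ * A₂))⁻¹ *
        ((aevalAeval C.x C.y (A₁ * S₂) - algebraMap k C.FunField ((A₁ * S₂).evalEval a b)) -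
        algebraMap k C.FunField ((A₁ * S₂).evalEval a b / (S₁ * A₂).evalEval a b) *
        (aevalAeval C.x C.y (S₁ * A₂) - algebraMap k C.FunField ((S₁ * A₂).evalEval a b))) := by
      rw [map_div₀]
      have hE0 := hne _ hE
      have hE' := (map_ne_zero (algebraMap k C.FunField)).2 hE
      generalize aevalAeval C.x C.y (S₁ * A₂) = p at hE0 ⊢
      field_simp
      ring
    rw [h3, map_mul, map_inv₀, hM1, inv_one, one_mul]
    refine w.map_sub_lt hN ?_
    rw [map_mul, mul_comm]
    exact mul_lt_one_of_lt_of_le hM (Valuation.map_algebraMap_le_one hw _)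

theorem HasCoords.pow_eq {C : CyclicCover k n d} {P : Place k C.FunField} {a b : k}
    (h : C.HasCoords P a b) : b ^ d = C.f.eval a := by
  have hw := P.trivial_on_constants
  have h1 := Valuation.aeval_sub_lt hw h.1 C.f
  have h2 := Valuation.aeval_sub_lt hw h.2 (X ^ d)
  simp only [map_pow, aeval_X, eval_pow, eval_X, y_pow] at h2
  exact Valuation.value_unique hw (by simpa using h2) h1

/-- The function `x - a` is a local parameter at `(a, b)`, `b ≠ 0`. -/
theorem HasCoords.val_x_sub {C : CyclicCover k n d} {P : Place k C.FunField} {a b : k}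
    (h : C.HasCoords P a b) (hb : b ≠ 0) :
    P.val (C.x - algebraMap k C.FunField a) = exp (-1) := by
  have hw := P.trivial_on_constants
  obtain ⟨g, hg⟩ := P.surjective (exp (-1))
  have hg0 : g ≠ 0 := by
    rintro rfl
    rw [map_zero] at hg
    exact exp_ne_zero hg.symm
  obtain ⟨m, c, u, hc, hgu, hu⟩ := C.exists_order hw hb h.pow_eq h.1 h.2 hg0
  have hx0 := P.val.ne_zero_iff.2 (C.x_sub_ne_zero a)
  -- This becomes m · log w(x - a) = -1, so the logarithm is ±1; it is negative because x - a
  -- vanishes at P.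
  have h1 := congrArg log hg
  rw [hgu, map_mul, Valuation.map_eq_one_of_sub_lt hw hc (hu _ hw h.1 h.2), mul_one, map_zpow₀,
    log_zpow, log_exp, smul_eq_mul] at h1
  have h2 : P.val (C.x - algebraMap k C.FunField a) < 1 := h.1
  rw [← exp_log hx0, ← exp_zero, exp_lt_exp] at h2
  rcases Int.eq_one_or_neg_one_of_mul_eq_neg_one h1 with h3 | h3
  · rw [← exp_log hx0]
    rw [h3] at h1
    congr 1
    omega
  · rw [h3] at h1
    omega

/-- A factorization g = (x - a)^m u from `exists_order` serves both places, and x - a has order one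
at each. -/
theorem HasCoords.place_unique {C : CyclicCover k n d} {P Q : Place k C.FunField} {a b : k}
    (hP : C.HasCoords P a b) (hQ : C.HasCoords Q a b) (hb : b ≠ 0) : P = Q := by
  refine Place.ext (Valuation.ext fun g => ?_)
  by_cases hg : g = 0
  · simp [hg]
  have hw := P.trivial_on_constants
  have hw' := Q.trivial_on_constants
  obtain ⟨m, c, u, hc, hgu, hu⟩ := C.exists_order hw hb hP.pow_eq hP.1 hP.2 hg
  rw [hgu, map_mul, map_mul, Valuation.map_eq_one_of_sub_lt hw hc (hu _ hw hP.1 hP.2),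
    Valuation.map_eq_one_of_sub_lt hw' hc (hu _ hw' hQ.1 hQ.2), map_zpow₀, map_zpow₀,
    hP.val_x_sub hb, hQ.val_x_sub hb]

/-! ### Points defined over the smaller field -/

section Rationality

variable {K : Type*} [Field K] [Algebra k K]

theorem ratFuncBaseChange_algebraMap (p : k[X]) :
    ratFuncBaseChange k K (algebraMap k[X] (RatFunc k) p) =
      algebraMap K[X] (RatFunc K) (p.map (algebraMap k K)) := by
  have h := RatFunc.map_apply_div (Polynomial.mapRingHom (algebraMap k K))
    (nonZeroDivisors_le_comap_nonZeroDivisors_of_injective _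
      (Polynomial.map_injective _ (algebraMap k K).injective)) p 1
  simpa [ratFuncBaseChange, RatFunc.coe_mapRingHom_eq_coe_map] using h

theorem funBaseChange_of (r : RatFunc k) : C.funBaseChange K (AdjoinRoot.of _ r) =
    AdjoinRoot.of _ (ratFuncBaseChange k K r) := AdjoinRoot.map_of ..

theorem funBaseChange_aeval (p : k[X]) : C.funBaseChange K (aeval C.x p) =
    aeval (C.baseChange K).x (p.map (algebraMap k K)) := by
  rw [← of_algebraMap, funBaseChange_of, ratFuncBaseChange_algebraMap, of_algebraMap]

theorem funBaseChange_x : C.funBaseChange K C.x = (C.baseChange K).x := by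
  simpa using C.funBaseChange_aeval (K := K) X

theorem funBaseChange_y : C.funBaseChange K C.y = (C.baseChange K).y := AdjoinRoot.map_root ..

theorem funBaseChange_algebraMap (c : k) : C.funBaseChange K (algebraMap k C.FunField c) =
    algebraMap K (C.baseChange K).FunField (algebraMap k K c) := by
  simpa using C.funBaseChange_aeval (K := K) (Polynomial.C c)

/-- A point with coordinates in `k`, the second one nonzero, is a `k`-point. -/
theorem HasCoords.isRational {C : CyclicCover k n d} {P : Place K (C.baseChange K).FunField}
    {a b : k} (h : (C.baseChange K).HasCoords P (algebraMap k K a) (algebraMap k K b))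
    (hb : b ≠ 0) : C.IsRational P := by
  intro g hg
  by_cases hg0 : g = 0
  · exact ⟨0, by simp [hg0, Place.TakesValue]⟩
  -- The restriction of P to k(C) is centred at (a, b), so `exists_order` applies over k and yields
  -- values in k: m < 0 is excluded by regularity, m = 0 gives the value c, and m > 0 gives 0.
  let w : Valuation C.FunField ℤᵐ⁰ := P.val.comap (C.funBaseChange K)
  have hw : ∀ c : k, c ≠ 0 → w (algebraMap k C.FunField c) = 1 := by
    intro c hc
    simp only [w, Valuation.comap_apply, funBaseChange_algebraMap]
    exact P.trivial_on_constants _ (by simpa using hc)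
  have hx : w (C.x - algebraMap k C.FunField a) < 1 := by
    simp only [w, Valuation.comap_apply, map_sub, funBaseChange_algebraMap, funBaseChange_x]
    exact h.1
  have hy : w (C.y - algebraMap k C.FunField b) < 1 := by
    simp only [w, Valuation.comap_apply, map_sub, funBaseChange_algebraMap, funBaseChange_y]
    exact h.2
  have hab : b ^ d = C.f.eval a := by
    apply (algebraMap k K).injective
    rw [map_pow, h.pow_eq, baseChange, eval_map_algebraMap,
      ← aeval_algebraMap_apply_eq_algebraMap_eval]
  obtain ⟨m, c, u, hc, hgu, hu⟩ := C.exists_order hw hb hab hx hy hg0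
  have hwg : w g ≤ 1 := hg
  have hu1 := hu w hw hx hy
  have huw := Valuation.map_eq_one_of_sub_lt hw hc hu1
  suffices h : ∃ e : k, w (g - algebraMap k C.FunField e) < 1 by
    obtain ⟨e, he⟩ := h
    refine ⟨e, ?_⟩
    rw [Place.TakesValue, ← funBaseChange_algebraMap, ← map_sub]
    exact he
  have hx0 := w.ne_zero_iff.2 (C.x_sub_ne_zero a)
  rcases lt_trichotomy m 0 with hm | rfl | hm
  · rw [hgu, map_mul, huw, mul_one, map_zpow₀] at hwg
    exact absurd hwg (not_le.2 (one_lt_zpow_of_neg₀ (zero_lt_iff.2 hx0) hx hm))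
  · exact ⟨c, by simpa [hgu] using hu1⟩
  · refine ⟨0, ?_⟩
    rw [map_zero, sub_zero, hgu, map_mul, huw, mul_one, map_zpow₀]
    lift m to ℕ using hm.le
    rw [zpow_natCast]
    exact pow_lt_one₀ zero_le hx (by omega)

end Rationality

end CyclicCover

namespace CyclicCover

variable {k : Type*} [Field k] {n d : ℕ} (C : CyclicCover k n d)

/-! ### The point at infinity and the affine points -/

theorem one_lt_val_infinity_x : 1 < C.infinity.val C.x :=
  C.existsUnique_place_at_infinity.choose_spec.1

theorem eq_infinity {P : Place k C.FunField} (hP : 1 < P.val C.x) : P = C.infinity :=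
  C.existsUnique_place_at_infinity.unique hP C.one_lt_val_infinity_x

theorem ne_infinity_iff {P : Place k C.FunField} : P ≠ C.infinity ↔ P.val C.x ≤ 1 := by
  refine ⟨fun h => not_lt.1 fun h1 => h (C.eq_infinity h1), ?_⟩
  rintro h rfl
  exact absurd C.one_lt_val_infinity_x (not_lt.2 h)

theorem val_y_le_one {P : Place k C.FunField} (hP : P.val C.x ≤ 1) : P.val C.y ≤ 1 := by
  have h := Valuation.aeval_le_one P.trivial_on_constants hP C.f
  rw [← y_pow, map_pow] at h
  exact (pow_le_one_iff C.d_pos.ne').1 h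

theorem val_x_le_one_of_takesValue {P : Place k C.FunField} {a : k} (h : P.TakesValue C.x a) :
    P.val C.x ≤ 1 := Valuation.map_le_one_of_sub_lt P.trivial_on_constants h

theorem weight_algebraMap {p : k[X]} (hp : p ≠ 0) (i : ℕ) :
    weight n d (algebraMap k[X] (RatFunc k) p) i = exp ((d : ℤ) * p.natDegree + n * i) := by
  simp [weight, hp, RatFunc.intDegree_polynomial]

/-- The pole order of a nonzero term with y^i is congruent to n i modulo d. These classes are
distinct for i < d, so the largest term cannot be cancelled. -/
theorem val_infinity {A : k[X][X]} (hA : A.natDegree < d) : ∃ j < d,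
    (∀ i < d, weight n d (algebraMap k[X] (RatFunc k) (A.coeff i)) i ≤
      weight n d (algebraMap k[X] (RatFunc k) (A.coeff j)) j) ∧
    C.infinity.val (aevalAeval C.x C.y A) =
      weight n d (algebraMap k[X] (RatFunc k) (A.coeff j)) j := by
  have h := C.val_of_place_at_infinity C.infinity C.one_lt_val_infinity_x
    (A.map (algebraMap k[X] (RatFunc k))) (natDegree_map_le.trans_lt hA)
  rw [aevalAeval_map] at h
  simpa only [coeff_map] using h

/-! ### Points with given coordinates -/

/-- The place comes from a maximal ideal over (X - c) in the integral closure of k[X], which is a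
Dedekind domain because the function field is finite and separable over k(x), d being nonzero in k.
-/
theorem exists_place_above (c : k) : ∃ P : Place k C.FunField, P.TakesValue C.x c := by
  have hd : d ≠ 0 := C.d_pos.ne'
  have hmonic : C.equation.Monic := monic_X_pow_sub_C _ hd
  have hf : algebraMap k[X] (RatFunc k) C.f ≠ 0 := by simpa using C.f_ne_zero
  have hdk : (d : RatFunc k) ≠ 0 := by
    have h := (map_ne_zero (algebraMap k (RatFunc k))).2 C.char_not_dvd
    rwa [map_natCast] at h
  have hsep : C.equation.Separable := separable_X_pow_sub_C _ hdk hf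
  have : FiniteDimensional (RatFunc k) C.FunField := hmonic.finite_adjoinRoot
  have : Algebra.IsSeparable (RatFunc k) C.FunField := by
    have h1 : IsSeparable (RatFunc k) (AdjoinRoot.root C.equation) := by
      rw [IsSeparable, AdjoinRoot.minpoly_root C.irreducible_equation.ne_zero, hmonic.leadingCoeff]
      simpa using hsep
    have h2 := (IntermediateField.isSeparable_adjoin_simple_iff_isSeparable _ _).2 h1
    rw [IntermediateField.adjoin_root_eq_top] at h2
    exact Algebra.IsSeparable.of_algHom _ _
      (IntermediateField.topEquiv (F := RatFunc k) (E := C.FunField)).symm.toAlgHom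
  let B := integralClosure k[X] C.FunField
  have : IsDedekindDomain B := integralClosure.isDedekindDomain k[X] (RatFunc k) C.FunField
  have : IsFractionRing B C.FunField :=
    integralClosure.isFractionRing_of_finite_extension (RatFunc k) C.FunField
  have hAF : ∀ p : k[X], algebraMap k[X] C.FunField p = aeval C.x p := C.of_algebraMap
  have hAB : Function.Injective (algebraMap k[X] B) := by
    intro r s h
    have h1 := congrArg (algebraMap B C.FunField) h
    rw [← IsScalarTower.algebraMap_apply, ← IsScalarTower.algebraMap_apply, hAF, hAF] at h1
    exact C.aeval_x_injective h1
  have : FaithfulSMul k[X] B := (faithfulSMul_iff_algebraMap_injective k[X] B).2 hAB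
  have hprime : Prime (X - Polynomial.C c) := prime_X_sub_C c
  have hmax : (Ideal.span {X - Polynomial.C c}).IsMaximal :=
    PrincipalIdealRing.isMaximal_of_irreducible hprime.irreducible
  obtain ⟨P, hPm, hP⟩ := Ideal.exists_maximal_ideal_liesOver_of_isIntegral (S := B)
    (Ideal.span {X - Polynomial.C c})
  have htP : algebraMap k[X] B (X - Polynomial.C c) ∈ P := by
    rw [← Ideal.mem_comap, ← Ideal.under_def, ← hP.over]
    exact Ideal.mem_span_singleton_self _
  have hP0 : P ≠ ⊥ := by
    rintro rfl
    exact hprime.ne_zero (hAB (by rw [Ideal.mem_bot.1 htP, map_zero]))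
  let w : IsDedekindDomain.HeightOneSpectrum B := ⟨P, hPm.isPrime, hP0⟩
  have hle : ∀ p : k[X], w.valuation C.FunField (aeval C.x p) ≤ 1 := fun p => by
    rw [← hAF, IsScalarTower.algebraMap_apply k[X] B C.FunField]
    exact w.valuation_le_one _
  have hconst : ∀ c : k, w.valuation C.FunField (algebraMap k C.FunField c) ≤ 1 := fun c => by
    simpa using hle (Polynomial.C c)
  refine ⟨⟨w.valuation C.FunField, ?_, w.valuation_surjective C.FunField⟩, ?_⟩
  · intro c hc
    refine le_antisymm (hconst c) ?_
    have h1 := hconst c⁻¹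
    rwa [map_inv₀, map_inv₀, inv_le_one₀ (zero_lt_iff.2 (by simpa using hc))] at h1
  · have h1 : w.valuation C.FunField
        (algebraMap B C.FunField (algebraMap k[X] B (X - Polynomial.C c))) < 1 :=
      (w.valuation_lt_one_iff_mem _).2 htP
    rw [← IsScalarTower.algebraMap_apply, hAF] at h1
    simpa [Place.TakesValue] using h1

/-- The automorphism of the function field that fixes `x` and sends `y` to `ζ y`. -/
noncomputable def rootEquiv {ζ : k} (hζ : ζ ^ d = 1) : C.FunField ≃ₐ[k] C.FunField :=
  substEquiv (C := C) (C' := C) 0 (b := ζ⁻¹)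
    (inv_ne_zero (by rintro rfl; simp [C.d_pos.ne'] at hζ)) (by simp [inv_pow, hζ])

theorem rootEquiv_x {ζ : k} (hζ : ζ ^ d = 1) : C.rootEquiv hζ C.x = C.x := by
  rw [rootEquiv, substEquiv_x]; simp

theorem rootEquiv_y {ζ : k} (hζ : ζ ^ d = 1) :
    C.rootEquiv hζ C.y = algebraMap k C.FunField ζ * C.y := by
  rw [rootEquiv, substEquiv_y]; simp

theorem rootEquiv_of {ζ : k} (hζ : ζ ^ d = 1) (r : RatFunc k) :
    C.rootEquiv hζ (AdjoinRoot.of _ r) = AdjoinRoot.of _ r := by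
  have h1 : ∀ p : k[X], C.rootEquiv hζ (aeval C.x p) = aeval C.x p := by
    intro p
    rw [← AlgEquiv.coe_toAlgHom, ← aeval_algHom_apply, AlgEquiv.coe_toAlgHom, rootEquiv_x]
  rw [← RatFunc.num_div_denom r, map_div₀, of_algebraMap, of_algebraMap, map_div₀, h1, h1]

theorem hasCoords_comap_rootEquiv {ζ : k} (hζ : ζ ^ d = 1) {P : Place k C.FunField} {a b : k}
    (h : C.HasCoords P a b) : C.HasCoords (P.comap (C.rootEquiv hζ)) a (ζ * b) := by
  have hζ0 : ζ ≠ 0 := by rintro rfl; simp [C.d_pos.ne'] at hζ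
  constructor
  · rw [Place.TakesValue, Place.comap_val, map_sub, rootEquiv_x, AlgEquiv.commutes]
    exact h.1
  · rw [Place.TakesValue, Place.comap_val, map_sub, rootEquiv_y, AlgEquiv.commutes, map_mul,
      ← mul_sub, map_mul, P.trivial_on_constants ζ hζ0, one_mul]
    exact h.2

/-- y^d - f(c) is the product of the y - e over the d-th roots e of f(c). It has valuation less than
1, whereas all factors would have valuation 1 if y had no value in k. -/
theorem exists_takesValue_y [IsAlgClosed k] {P : Place k C.FunField} {c : k}
    (h : P.TakesValue C.x c) : ∃ e : k, C.HasCoords P c e := by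
  have hw := P.trivial_on_constants
  have hs : (X ^ d - Polynomial.C (C.f.eval c)).Splits := IsAlgClosed.splits _
  have hm : (X ^ d - Polynomial.C (C.f.eval c)).Monic := monic_X_pow_sub_C _ C.d_pos.ne'
  have h1 := Valuation.aeval_sub_lt hw h C.f
  rw [← y_pow] at h1
  by_contra hne
  push Not at hne
  have h2 : ∀ e : k, P.val (C.y - algebraMap k C.FunField e) = 1 := by
    intro e
    refine le_antisymm ?_ (not_lt.1 fun h3 => hne e ⟨h, h3⟩)
    exact P.val.map_sub_le (C.val_y_le_one (C.val_x_le_one_of_takesValue h))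
      (Valuation.map_algebraMap_le_one hw e)
  have h3 := congrArg (fun p => P.val (aeval C.y p)) (hs.eq_prod_roots_of_monic hm)
  simp only [map_sub, map_pow, aeval_X, aeval_C, map_multiset_prod, Multiset.map_map] at h3
  rw [h3, Multiset.prod_eq_one] at h1
  · exact lt_irrefl _ h1
  · intro z hz
    obtain ⟨e, -, rfl⟩ := Multiset.mem_map.1 hz
    simpa using h2 e

/-- Any place above c has a second coordinate e with e^d = b^d; for e ≠ 0 the automorphism y ↦ (b/e)
y changes it to b. -/
theorem exists_place_hasCoords [IsAlgClosed k] {c b : k} (hb : b ^ d = C.f.eval c) :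
    ∃ P : Place k C.FunField, C.HasCoords P c b := by
  obtain ⟨P, hP⟩ := C.exists_place_above c
  obtain ⟨e, he⟩ := C.exists_takesValue_y hP
  have h1 := he.pow_eq
  by_cases he0 : e = 0
  · have hb0 : b = 0 := by
      rw [← hb, he0, zero_pow C.d_pos.ne'] at h1
      exact pow_eq_zero_iff C.d_pos.ne' |>.1 h1.symm
    exact ⟨P, by rwa [hb0, ← he0]⟩
  · have hζ : (b / e) ^ d = 1 := by
      rw [div_pow, hb, h1, div_self (h1 ▸ pow_ne_zero _ he0)]
    have h2 := C.hasCoords_comap_rootEquiv hζ he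
    rw [div_mul_cancel₀ _ he0] at h2
    exact ⟨_, h2⟩

/-! ### Functions without poles outside the point at infinity -/

/-- Let c be a root of the denominator, with P above c. Regularity gives i · ord y ≥ ord(x - c) > 0.
This fails if f(c) ≠ 0, as then ord y = 0. If f(c) = 0, the root is simple, so ord(x - c) = d · ord
y with ord y > 0, contrary to i < d. -/
theorem isPolynomial_of_regular {r : RatFunc k} [IsAlgClosed k] {i : ℕ} (hi : i < d)
    (h : ∀ P : Place k C.FunField, P ≠ C.infinity →
      P.val (AdjoinRoot.of C.equation r * C.y ^ i) ≤ 1) :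
    r ∈ (algebraMap k[X] (RatFunc k)).range := by
  by_cases hu : IsUnit r.denom
  · obtain ⟨u, hu0, hu⟩ := Polynomial.isUnit_iff.1 hu
    have h1 := r.monic_denom
    rw [← hu, Monic, leadingCoeff_C] at h1
    refine ⟨r.num, ?_⟩
    conv_rhs => rw [← RatFunc.num_div_denom r, ← hu, h1]
    simp
  exfalso
  obtain ⟨c, hc⟩ := IsAlgClosed.exists_root r.denom
    fun h0 => hu (isUnit_iff_degree_eq_zero.2 h0)
  obtain ⟨P, hP⟩ := C.exists_place_above c
  have hw := P.trivial_on_constants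
  have hx1 := C.val_x_le_one_of_takesValue hP
  have hnum : r.num.eval c ≠ 0 := by
    intro h0
    obtain ⟨u, v, huv⟩ := r.isCoprime_num_denom
    have := congrArg (eval c) huv
    simp [h0, hc.eq_zero] at this
  have hn1 := Valuation.map_eq_one_of_sub_lt hw hnum (Valuation.aeval_sub_lt hw hP r.num)
  have hd0 := P.val.ne_zero_iff.2 (C.aeval_x_ne_zero r.denom_ne_zero)
  have h1 := h P (C.ne_infinity_iff.2 hx1)
  rw [← RatFunc.num_div_denom r, map_div₀, of_algebraMap, of_algebraMap, map_mul, map_div₀, hn1,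
    map_pow, one_div, inv_mul_le_iff₀ (zero_lt_iff.2 hd0), mul_one] at h1
  obtain ⟨q, hq⟩ := dvd_iff_isRoot.2 hc
  have h2 : P.val (aeval C.x r.denom) ≤ P.val (C.x - algebraMap k C.FunField c) := by
    rw [hq, map_mul, map_mul]
    simpa using mul_le_of_le_one_right' (Valuation.aeval_le_one hw hx1 q)
  have h3 := h1.trans h2
  have hyd : P.val C.y ^ d = P.val (aeval C.x C.f) := by rw [← map_pow, y_pow]
  by_cases hf : C.f.eval c = 0
  · obtain ⟨f₁, hf₁⟩ := dvd_iff_isRoot.2 hf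
    have h4 : f₁.eval c ≠ 0 := by
      intro h0
      obtain ⟨f₂, hf₂⟩ := dvd_iff_isRoot.2 h0
      have hsq := C.separable_f.squarefree (X - Polynomial.C c) ⟨f₂, by rw [hf₁, hf₂, mul_assoc]⟩
      exact (irreducible_X_sub_C c).not_isUnit hsq
    have h5 := Valuation.map_eq_one_of_sub_lt hw h4 (Valuation.aeval_sub_lt hw hP f₁)
    rw [hf₁, map_mul, map_mul, h5, mul_one] at hyd
    have hyd' : P.val C.y ^ d = P.val (C.x - algebraMap k C.FunField c) := by simpa using hyd
    rw [← hyd'] at h3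
    have hy1 : P.val C.y < 1 := by
      rw [← pow_lt_one_iff C.d_pos.ne', hyd']
      exact hP
    have hy0 : 0 < P.val C.y := by
      rw [zero_lt_iff]
      intro h0
      rw [h0, zero_pow C.d_pos.ne'] at hyd'
      exact P.val.ne_zero_iff.2 (C.x_sub_ne_zero c) hyd'.symm
    exact absurd h3 (not_le.2 (pow_lt_pow_right_of_lt_one₀ hy0 hy1 hi))
  · have h4 := Valuation.map_eq_one_of_sub_lt hw hf (Valuation.aeval_sub_lt hw hP C.f)
    rw [h4] at hyd
    have hy1 : P.val C.y = 1 := (pow_eq_one_iff_of_nonneg zero_le C.d_pos.ne').1 hyd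
    rw [hy1, one_pow] at h3
    exact absurd hP (not_lt.2 h3)

/-- The term with y^i is isolated by averaging over the automorphisms y ↦ ζ^j y with the characters
ζ^(-ij). They fix x, hence permute the affine places, and d is a unit. -/
theorem val_coeff_le_one [IsAlgClosed k] {p : (RatFunc k)[X]} (hp : p.natDegree < d)
    (h : ∀ P : Place k C.FunField, P ≠ C.infinity → P.val (AdjoinRoot.mk C.equation p) ≤ 1)
    {i : ℕ} (hi : i < d) {P : Place k C.FunField} (hP : P ≠ C.infinity) :
    P.val (AdjoinRoot.of C.equation (p.coeff i) * C.y ^ i) ≤ 1 := by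
  have : NeZero (d : k) := ⟨C.char_not_dvd⟩
  have : NeZero d := ⟨C.d_pos.ne'⟩
  obtain ⟨ζ, hζ⟩ := HasEnoughRootsOfUnity.exists_primitiveRoot k d
  have hζ0 : ζ ≠ 0 := hζ.ne_zero C.d_pos.ne'
  have hw := P.trivial_on_constants
  have hζj : ∀ j, (ζ ^ j) ^ d = 1 := fun j => by rw [← pow_mul', pow_mul, hζ.pow_eq_one, one_pow]
  have hsum : AdjoinRoot.mk C.equation p =
      ∑ l ∈ Finset.range d, AdjoinRoot.of C.equation (p.coeff l) * C.y ^ l := by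
    conv_lhs => rw [p.as_sum_range_C_mul_X_pow' hp]
    simp [y]
  have h1 : ∀ j, P.val (C.rootEquiv (hζj j) (AdjoinRoot.mk C.equation p)) ≤ 1 := by
    intro j
    refine h (P.comap (C.rootEquiv (hζj j))) ?_
    rw [ne_infinity_iff, Place.comap_val, rootEquiv_x]
    exact C.ne_infinity_iff.1 hP
  have h2 : ∑ j ∈ Finset.range d, algebraMap k C.FunField ((ζ⁻¹ ^ i) ^ j) *
      C.rootEquiv (hζj j) (AdjoinRoot.mk C.equation p) =
      algebraMap k C.FunField d * (AdjoinRoot.of C.equation (p.coeff i) * C.y ^ i) := by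
    have h3 : ∀ j l, algebraMap k C.FunField ((ζ⁻¹ ^ i) ^ j) *
        C.rootEquiv (hζj j) (AdjoinRoot.of C.equation (p.coeff l) * C.y ^ l) =
        algebraMap k C.FunField ((ζ⁻¹ ^ i * ζ ^ l) ^ j) *
          (AdjoinRoot.of C.equation (p.coeff l) * C.y ^ l) := by
      intro j l
      rw [map_mul (C.rootEquiv (hζj j)), map_pow (C.rootEquiv (hζj j)), rootEquiv_of, rootEquiv_y,
        mul_pow, mul_pow, map_mul, ← map_pow, ← pow_mul ζ, ← pow_mul ζ, mul_comm j l]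
      ring
    rw [hsum]
    simp_rw [map_sum, Finset.mul_sum, h3]
    rw [Finset.sum_comm, Finset.sum_eq_single i]
    · rw [← Finset.sum_mul, inv_pow, inv_mul_cancel₀ (pow_ne_zero _ hζ0)]
      simp
    · intro l hl hli
      rw [← Finset.sum_mul, ← map_sum]
      have hne : ζ⁻¹ ^ i * ζ ^ l ≠ 1 := by
        intro h4
        rw [inv_pow, inv_mul_eq_one₀ (pow_ne_zero _ hζ0)] at h4
        exact hli (hζ.pow_inj hi (Finset.mem_range.1 hl) h4).symm
      have h5 := geom_sum_mul (ζ⁻¹ ^ i * ζ ^ l) d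
      have h6 : (ζ⁻¹ ^ i * ζ ^ l) ^ d = 1 := by
        rw [mul_pow, hζj, inv_pow, inv_pow, hζj]
        simp
      rw [h6, sub_self, mul_eq_zero, or_iff_left (sub_ne_zero.2 hne)] at h5
      rw [h5, map_zero, zero_mul]
    · intro h4
      exact absurd (Finset.mem_range.2 hi) h4
  have h3 : P.val (algebraMap k C.FunField d * (AdjoinRoot.of C.equation (p.coeff i) * C.y ^ i)) ≤
      1 := by
    rw [← h2]
    refine P.val.map_sum_le fun j _ => ?_
    rw [map_mul]
    exact mul_le_one' (Valuation.map_algebraMap_le_one hw _) (h1 j)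
  rwa [map_mul, hw _ C.char_not_dvd, one_mul] at h3

/-- A function without poles outside the point at infinity is a polynomial in `x` and `y`. -/
theorem exists_aevalAeval_of_regular [IsAlgClosed k] {g : C.FunField}
    (hg : ∀ P : Place k C.FunField, P ≠ C.infinity → P.val g ≤ 1) :
    ∃ A : k[X][X], A.natDegree < d ∧ aevalAeval C.x C.y A = g := by
  obtain ⟨p, hp, rfl⟩ := C.exists_representative g
  have h : p ∈ lifts (algebraMap k[X] (RatFunc k)) := by
    rw [lifts_iff_coeff_lifts]
    intro i
    by_cases hi : i < d
    · exact C.isPolynomial_of_regular hi fun P hP => C.val_coeff_le_one hp hg hi hP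
    · rw [coeff_eq_zero_of_natDegree_lt (by omega)]
      exact ⟨0, map_zero _⟩
  obtain ⟨A, rfl⟩ := (mem_lifts _).1 h
  refine ⟨A, ?_, (C.aevalAeval_map A).symm⟩
  rwa [natDegree_map_eq_of_injective (IsFractionRing.injective k[X] (RatFunc k))] at hp

/-! ### Torsion points -/

/-- Torsion in terms of a function with divisor m(P) - m(O); order z corresponds to the
multiplicative value `exp (-z)`, whence `exp m` at the pole. -/
theorem nsmul_abelJacobi_eq_zero_iff [IsAlgClosed k] {P : Place k C.FunField}
    (hP : P ≠ C.infinity) (m : ℕ) : m • abelJacobi C.infinity P = 0 ↔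
      ∃ g : C.FunField, P.val g = exp (-(m : ℤ)) ∧ C.infinity.val g = exp (m : ℤ) ∧
        ∀ Q, Q ≠ P → Q ≠ C.infinity → Q.val g = 1 := by
  have h1 : m • abelJacobi C.infinity P = 0 ↔ ∃ g : C.FunField, g ≠ 0 ∧ ∀ Q : Place k C.FunField,
      (m • (Finsupp.single P 1 - Finsupp.single C.infinity 1) : Place k C.FunField →₀ ℤ) Q =
        Q.ord g := by
    rw [abelJacobi, ← QuotientAddGroup.mk_nsmul, QuotientAddGroup.eq_zero_iff]
    rfl
  rw [h1]
  have h2 : ∀ (Q : Place k C.FunField) (g : C.FunField), g ≠ 0 → ∀ z : ℤ,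
      (z = Q.ord g ↔ Q.val g = exp (-z)) := by
    intro Q g hg z
    have h3 := Q.val.ne_zero_iff.2 hg
    rw [Place.ord]
    constructor
    · rintro rfl
      rw [neg_neg, exp_log h3]
    · intro h4
      rw [h4, log_exp, neg_neg]
  constructor
  · rintro ⟨g, hg, h⟩
    refine ⟨g, ?_, ?_, ?_⟩
    · rw [← h2 P g hg, ← h]
      simp [hP.symm]
    · rw [← neg_neg (m : ℤ), ← h2 _ g hg, ← h]
      simp [hP]
    · intro Q hQP hQ
      rw [← exp_zero, ← neg_zero, ← h2 _ g hg, ← h]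
      simp [hQP.symm, hQ.symm]
  · rintro ⟨g, hgP, hgO, hg⟩
    have hg0 : g ≠ 0 := by
      rintro rfl
      rw [map_zero] at hgP
      exact exp_ne_zero hgP.symm
    refine ⟨g, hg0, fun Q => ?_⟩
    rw [h2 _ _ hg0]
    by_cases hQP : Q = P
    · subst hQP
      rw [hgP]
      simp [hP.symm]
    by_cases hQ : Q = C.infinity
    · subst hQ
      rw [hgO]
      simp [hP]
    · rw [hg Q hQP hQ]
      simp [Ne.symm hQP, Ne.symm hQ]

end CyclicCover

/-! ### Polynomials -/

namespace Polynomial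

variable {K : Type*} [Field K]

theorem eq_C_mul_X_sub_C_pow [IsAlgClosed K] {p : K[X]} {a : K}
    (h : ∀ c, p.eval c = 0 → c = a) : p = C p.leadingCoeff * (X - C a) ^ p.natDegree := by
  by_cases hp : p = 0
  · simp [hp]
  have hs : p.Splits := IsAlgClosed.splits p
  have h1 : p.roots = Multiset.replicate p.natDegree a := by
    rw [Multiset.eq_replicate]
    exact ⟨hs.natDegree_eq_card_roots.symm, fun c hc => h c (isRoot_of_mem_roots hc)⟩
  conv_lhs => rw [hs.eq_prod_roots, h1]
  simp

/-- A `d`-th root of a power series modulo `X ^ N` is defined over the subfield generated by its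
constant term and the coefficients of the power series. -/
theorem coeff_mem_of_coeff_pow_mem {R : Subring K} (hR : ∀ c ∈ R, c⁻¹ ∈ R) {d N : ℕ}
    (hd : (d : K) ≠ 0) {u : K[X]} (hu : u.coeff 0 ≠ 0) (hu0 : u.coeff 0 ∈ R)
    (h : ∀ i < N, (u ^ d).coeff i ∈ R) (i : ℕ) (hi : i < N) : u.coeff i ∈ R := by
  induction i using Nat.strong_induction_on with
  | _ i ih =>
  rcases Nat.eq_zero_or_pos i with rfl | hi0
  · exact hu0
  -- Truncation of u below degree i, so that u = t + X^i s with s(0) the coefficient sought. By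
  -- induction t has coefficients in R.
  let t : K[X] := ∑ j ∈ Finset.range i, C (u.coeff j) * X ^ j
  have htc : ∀ j, t.coeff j = if j < i then u.coeff j else 0 := by
    intro j
    simp [t, finsetSum_coeff, coeff_X_pow]
  obtain ⟨s, hs⟩ : X ^ i ∣ u - t := by
    rw [X_pow_dvd_iff]
    intro j hj
    simp [htc, hj]
  have hs0 : s.coeff 0 = u.coeff i := by
    have h1 := congrArg (coeff · i) hs
    simpa [htc, coeff_X_pow_mul'] using h1.symm
  have ht : t ∈ lifts R.subtype := by
    rw [lifts_iff_coeff_lifts]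
    intro j
    rw [htc]
    split_ifs with hj
    · exact ⟨⟨_, ih j hj (hj.trans hi)⟩, rfl⟩
    · exact ⟨0, map_zero _⟩
  obtain ⟨⟨z, hz⟩, hz'⟩ := (lifts_iff_coeff_lifts _).1 (pow_mem ht d) i
  have hzt : (t ^ d).coeff i ∈ R := by rw [← hz']; exact hz
  obtain ⟨e, he⟩ := powAddExpansion t (X ^ i * s) d
  rw [← hs, add_sub_cancel, hs] at he
  -- The part of (t + X^i s)^d of order at least two in X^i s is divisible by X^(2i), and i > 0.
  -- Only the linear term involves the unknown coefficient, with the invertible factor d u(0)^(d-1).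
  have h2 : (u ^ d).coeff i = (t ^ d).coeff i + d * u.coeff 0 ^ (d - 1) * u.coeff i := by
    rw [he, coeff_add, coeff_add]
    have e1 : (d : K[X]) * t ^ (d - 1) * (X ^ i * s) = X ^ i * ((d : K[X]) * t ^ (d - 1) * s) := by ring
    have e2 : e * (X ^ i * s) ^ 2 = X ^ (i + i) * (e * s ^ 2) := by ring
    rw [e1, e2, coeff_X_pow_mul', coeff_X_pow_mul', if_pos le_rfl, if_neg (by omega), Nat.sub_self,
      add_zero, mul_coeff_zero, mul_coeff_zero, hs0, coeff_zero_eq_eval_zero (t ^ _), eval_pow,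
      ← coeff_zero_eq_eval_zero, htc, if_pos hi0]
    simp
  have hc : (d : K) * u.coeff 0 ^ (d - 1) ≠ 0 := mul_ne_zero hd (pow_ne_zero _ hu)
  have h3 : u.coeff i = (d * u.coeff 0 ^ (d - 1))⁻¹ * ((u ^ d).coeff i - (t ^ d).coeff i) := by
    rw [h2]
    field_simp
    ring
  rw [h3]
  exact mul_mem (hR _ (mul_mem (natCast_mem R d) (pow_mem hu0 _))) (sub_mem (h i hi) hzt)

/-- A polynomial `v` whose `d`-th power is defined over `k` modulo `(X - a) ^ N`, `N > deg v`, is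
defined over `k` if its value at `a` is in `k` and nonzero. -/
theorem mem_lifts_of_pow {k : Type*} [Field k] [Algebra k K] {d N : ℕ} (hd : (d : K) ≠ 0)
    {a c : k} {f : k[X]} {v r : K[X]} (hc : c ≠ 0) (hvc : v.eval (algebraMap k K a) = algebraMap k K c)
    (hv : v.natDegree < N)
    (h : v ^ d = f.map (algebraMap k K) + r * (X - C (algebraMap k K a)) ^ N) :
    v ∈ lifts (algebraMap k K) := by
  set u := v.comp (X + C (algebraMap k K a)) with hu
  have hu0 : u.coeff 0 = algebraMap k K c := by
    rw [coeff_zero_eq_eval_zero, hu, eval_comp]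
    simpa using hvc
  have h1 : u ^ d = (f.comp (X + C a)).map (algebraMap k K) +
      r.comp (X + C (algebraMap k K a)) * X ^ N := by
    rw [hu, ← pow_comp, h]
    simp [map_comp]
  have h2 : u ∈ lifts (algebraMap k K) := by
    rw [lifts_iff_coeff_lifts]
    intro i
    by_cases hi : i < N
    · refine coeff_mem_of_coeff_pow_mem (R := (algebraMap k K).range) ?_ hd
        (by rw [hu0]; simpa using hc) (by rw [hu0]; exact ⟨c, rfl⟩) (fun j hj => ?_) i hi
      · rintro _ ⟨e, rfl⟩
        exact ⟨e⁻¹, map_inv₀ _ _⟩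
      · rw [h1, coeff_add, coeff_mul_X_pow', if_neg (by omega), add_zero, coeff_map]
        exact ⟨_, rfl⟩
    · rw [coeff_eq_zero_of_natDegree_lt]
      · exact ⟨0, map_zero _⟩
      · rw [hu, natDegree_comp, natDegree_X_add_C, mul_one]
        omega
  obtain ⟨u₀, hu₀⟩ := (mem_lifts _).1 h2
  refine (mem_lifts _).2 ⟨u₀.comp (X - C a), ?_⟩
  rw [map_comp, hu₀, hu, comp_assoc]
  simp

end Polynomial

/-! ### Pole orders at infinity of y and of polynomials in x -/

namespace CyclicCover

variable {k : Type*} [Field k] {n d : ℕ} (C : CyclicCover k n d)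

theorem val_infinity_aeval {p : k[X]} (hp : p ≠ 0) :
    C.infinity.val (aeval C.x p) = exp ((d : ℤ) * p.natDegree) := by
  obtain ⟨j, hj, hmax, hval⟩ := C.val_infinity (A := Polynomial.C p) (by simpa using C.d_pos)
  have h0 := hmax 0 C.d_pos
  rw [coeff_C_zero, weight_algebraMap hp] at h0
  rw [aevalAeval_C] at hval
  by_cases hj0 : j = 0
  · subst hj0
    rw [hval, coeff_C_zero, weight_algebraMap hp]
    simp
  · rw [coeff_C_of_ne_zero hj0] at h0
    simp [weight] at h0

theorem val_infinity_y : C.infinity.val C.y = exp (n : ℤ) := by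
  have h := C.val_infinity_aeval C.f_ne_zero
  rw [← y_pow, map_pow, C.natDegree_f, ← nsmul_eq_mul, exp_nsmul] at h
  exact (pow_left_inj₀ zero_le zero_le C.d_pos.ne').1 h

/-! ### From a decomposition of `f` to a torsion point -/

section Decomposition

variable {C} {ℓ₀ m₀ : ℕ} {a B : k} {v : k[X]}

theorem geom_sum_mul_y_sub (h : C.IsDecomposition ℓ₀ m₀ a B v) :
    (∑ i ∈ Finset.range d, C.y ^ i * aeval C.x v ^ (d - 1 - i)) * (C.y - aeval C.x v) =
      -algebraMap k C.FunField (B ^ d) * (C.x - algebraMap k C.FunField a) ^ m₀ := by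
  rw [(Commute.all C.y (aeval C.x v)).geom_sum₂_mul d, y_pow, h.2.2.2.2]
  simp

/-- At P both y and v(x) take the value b, so the d terms add up to d b^(d-1) ≠ 0. -/
theorem val_geom_sum {P : Place k C.FunField} {a b : k} (hP : C.HasCoords P a b)
    (hb : v.eval a = b) (hb0 : b ≠ 0) :
    P.val (∑ i ∈ Finset.range d, C.y ^ i * aeval C.x v ^ (d - 1 - i)) = 1 := by
  let S : k[X][X] := ∑ i ∈ Finset.range d, X ^ i * Polynomial.C v ^ (d - 1 - i)
  have h1 : aevalAeval C.x C.y S = ∑ i ∈ Finset.range d, C.y ^ i * aeval C.x v ^ (d - 1 - i) := by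
    simp only [S, map_sum, map_mul, map_pow, aevalAeval_C, aevalAeval_Y]
  have h2 : S.evalEval a b = d * b ^ (d - 1) := by
    simp only [S, evalEval_finsetSum, evalEval_mul, evalEval_pow, evalEval_X, evalEval_C, hb]
    rw [Finset.sum_congr rfl fun i hi => by
      rw [← pow_add, show i + (d - 1 - i) = d - 1 by have := Finset.mem_range.1 hi; omega]]
    simp
  rw [← h1]
  exact Valuation.map_eq_one_of_sub_lt P.trivial_on_constants
    (h2 ▸ mul_ne_zero C.char_not_dvd (pow_ne_zero _ hb0))
    (Valuation.aevalAeval_sub_lt P.trivial_on_constants hP.1 hP.2 S)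

theorem hasCoords_of_val_y_sub_lt {P : Place k C.FunField} (hx : P.TakesValue C.x a)
    (h : P.val (C.y - aeval C.x v) < 1) : C.HasCoords P a (v.eval a) := by
  refine ⟨hx, ?_⟩
  have h1 := P.val.map_add_lt h (Valuation.aeval_sub_lt P.trivial_on_constants hx v)
  rwa [sub_add_sub_cancel] at h1

theorem HasCoords.val_y_sub_lt {P : Place k C.FunField} (h : C.HasCoords P a (v.eval a)) :
    P.val (C.y - aeval C.x v) < 1 := by
  have h1 := P.val.map_sub_lt h.2 (Valuation.aeval_sub_lt P.trivial_on_constants h.1 v)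
  rwa [sub_sub_sub_cancel_right] at h1

/-- The divisor of `y - v(x)` is `m₀ (P) - m₀ (O)`. -/
theorem nsmul_eq_zero_of_decomposition [IsAlgClosed k] (hm₀ : m₀ = d * ℓ₀) (hn : n < m₀)
    (h : C.IsDecomposition ℓ₀ m₀ a B v) {P : Place k C.FunField}
    (hP : C.HasCoords P a (v.eval a)) : m₀ • abelJacobi C.infinity P = 0 := by
  have hPO : P ≠ C.infinity := C.ne_infinity_iff.2 (C.val_x_le_one_of_takesValue hP.1)
  refine (C.nsmul_abelJacobi_eq_zero_iff hPO m₀).2 ⟨C.y - aeval C.x v, ?_, ?_, ?_⟩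
  -- The cofactor is a unit at P and x - a has order one, so y - v(x) has order m₀.
  · have h1 := congrArg P.val (geom_sum_mul_y_sub h)
    rwa [map_mul, val_geom_sum hP rfl h.2.2.2.1, one_mul, map_mul, Valuation.map_neg,
      P.trivial_on_constants _ (pow_ne_zero _ h.1), one_mul, map_pow, hP.val_x_sub h.2.2.2.1,
      ← exp_nsmul, nsmul_eq_mul, mul_neg_one] at h1
  · have hv : v ≠ 0 := by
      rintro rfl
      exact h.2.2.2.1 (by simp)
    have h1 := C.val_infinity_aeval hv
    rw [h.2.1] at h1
    -- The pole of v(x), of order d ℓ₀ = m₀ > n, dominates that of y.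
    rw [Valuation.map_sub_eq_of_lt_right, h1, hm₀]
    · simp
    · rw [h1, C.val_infinity_y, exp_lt_exp]
      exact_mod_cast hm₀ ▸ hn
  · intro Q hQP hQO
    have hx := C.ne_infinity_iff.1 hQO
    have hw := Q.trivial_on_constants
    refine le_antisymm (Q.val.map_sub_le (C.val_y_le_one hx) (Valuation.aeval_le_one hw hx v))
      (not_lt.1 fun hlt => hQP ?_)
    -- If y - v(x) vanishes at an affine point Q, then so does x - a; hence Q = (a, v(a)), which is
    -- P.
    have h1 := congrArg Q.val (geom_sum_mul_y_sub h)
    have hS : Q.val (∑ i ∈ Finset.range d, C.y ^ i * aeval C.x v ^ (d - 1 - i)) ≤ 1 := by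
      refine Q.val.map_sum_le fun i _ => ?_
      rw [map_mul, map_pow, map_pow]
      exact mul_le_one' (pow_le_one' (C.val_y_le_one hx) _)
        (pow_le_one' (Valuation.aeval_le_one hw hx v) _)
    have hlt' := mul_lt_one_of_lt_of_le hlt hS
    rw [mul_comm, ← map_mul, h1, map_mul, Valuation.map_neg, hw _ (pow_ne_zero _ h.1), one_mul,
      map_pow, pow_lt_one_iff (by omega)] at hlt'
    exact (hasCoords_of_val_y_sub_lt hlt' hlt).place_unique hP h.2.2.2.1

/-- Without cancellation at infinity, a nonzero coefficient of y^i forces a pole of order at least n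
i. -/
theorem coeff_eq_zero_of_val_infinity_lt {A : k[X][X]} (hA : A.natDegree < d) {m : ℤ}
    (h : C.infinity.val (aevalAeval C.x C.y A) ≤ exp m) {i : ℕ} (hi : m < n * i) :
    A.coeff i = 0 := by
  by_contra hne
  have hid : i < d := (le_natDegree_of_ne_zero hne).trans_lt hA
  obtain ⟨j, hj, hmax, hval⟩ := C.val_infinity hA
  have h1 := (hmax i hid).trans (hval.symm.le.trans h)
  rw [weight_algebraMap hne, exp_le_exp] at h1
  have : (0 : ℤ) ≤ d * (A.coeff i).natDegree := by positivity
  omega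

/-- A point `P` with `y(P) ≠ 0` has no multiple `m < n` equal to zero. -/
theorem nsmul_ne_zero_of_lt [IsAlgClosed k] {P : Place k C.FunField} {b : k}
    (hP : C.HasCoords P a b) (hb : b ≠ 0) {m : ℕ} (hm0 : m ≠ 0) (hm : m < n) :
    m • abelJacobi C.infinity P ≠ 0 := by
  intro h0
  have hPO : P ≠ C.infinity := C.ne_infinity_iff.2 (C.val_x_le_one_of_takesValue hP.1)
  obtain ⟨g, hgP, hgO, hg⟩ := (C.nsmul_abelJacobi_eq_zero_iff hPO m).1 h0
  have hlt : P.val g < 1 := by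
    rw [hgP, ← exp_zero, exp_lt_exp]
    omega
  obtain ⟨A, hA, rfl⟩ := C.exists_aevalAeval_of_regular (g := g) (fun Q hQ => by
    by_cases hQP : Q = P
    · rw [hQP]; exact hlt.le
    · exact (hg Q hQP hQ).le)
  -- A pole of order m < n leaves no room for y.
  have hAC : A = Polynomial.C (A.coeff 0) := by
    ext1 i
    rcases Nat.eq_zero_or_pos i with rfl | hi
    · simp
    · rw [coeff_C_of_ne_zero hi.ne']
      refine coeff_eq_zero_of_val_infinity_lt hA hgO.le ?_
      have : n * 1 ≤ n * i := Nat.mul_le_mul_left n hi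
      exact_mod_cast (by omega : m < n * i)
  rw [hAC, aevalAeval_C] at hlt hg
  have hroot : (A.coeff 0).eval a = 0 := by
    refine Valuation.value_unique P.trivial_on_constants
      (Valuation.aeval_sub_lt P.trivial_on_constants hP.1 (A.coeff 0)) ?_
    simpa using hlt
  have : NeZero (d : k) := ⟨C.char_not_dvd⟩
  have : NeZero d := ⟨C.d_pos.ne'⟩
  obtain ⟨ζ, hζ⟩ := HasEnoughRootsOfUnity.exists_primitiveRoot k d
  -- The conjugate point (a, ζ b) differs from P because b ≠ 0 and ζ ≠ 1. A polynomial in x that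
  -- vanishes at P vanishes there too, contrary to the divisor of g.
  have hP' := C.hasCoords_comap_rootEquiv hζ.pow_eq_one hP
  have hne : P.comap (C.rootEquiv hζ.pow_eq_one) ≠ P := by
    intro h1
    rw [h1] at hP'
    have h2 := Valuation.value_unique P.trivial_on_constants hP'.2 hP.2
    exact hζ.ne_one C.two_le ((mul_eq_right₀ hb).1 h2)
  have h1 := hg _ hne (C.ne_infinity_iff.2 (C.val_x_le_one_of_takesValue hP'.1))
  have h2 := Valuation.aeval_sub_lt (P.comap (C.rootEquiv hζ.pow_eq_one)).trivial_on_constants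
    hP'.1 (A.coeff 0)
  rw [hroot, map_zero, sub_zero] at h2
  exact h2.ne h1

theorem orderInJacobian_of_decomposition [IsAlgClosed k] (hm₀ : m₀ = d * ℓ₀) (hn : n < m₀)
    (hn' : m₀ < n + d) (h : C.IsDecomposition ℓ₀ m₀ a B v) {P : Place k C.FunField}
    (hP : C.HasCoords P a (v.eval a)) : C.orderInJacobian P = m₀ := by
  have h0 := nsmul_eq_zero_of_decomposition hm₀ hn h hP
  obtain ⟨e, he⟩ := addOrderOf_dvd_of_nsmul_eq_zero h0
  change m₀ = C.orderInJacobian P * e at he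
  by_contra hne
  have hdn := C.lt
  rcases e with _ | _ | e
  · omega
  · omega
  -- A proper divisor of m₀ is at most m₀/2, which is less than n because m₀ < n + d < 2n.
  · have h1 : 2 * C.orderInJacobian P ≤ m₀ := by rw [he]; nlinarith
    exact nsmul_ne_zero_of_lt hP h.2.2.2.1 (m := C.orderInJacobian P)
      (by intro h2; rw [h2] at he; omega) (by omega) (addOrderOf_nsmul_eq_zero _)

end Decomposition

/-! ### From a torsion point to a decomposition of `f` -/

section Torsion

variable {C} {ℓ₀ m₀ : ℕ} {a : k}

/-- At a place above a root c the function p(x) vanishes, so this place is P and c = a. -/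
theorem eval_eq_zero_of_place_unique {P : Place k C.FunField} (hP : P.TakesValue C.x a)
    {p : k[X]} (hp : ∀ Q, Q ≠ P → Q ≠ C.infinity → Q.val (aeval C.x p) = 1) (c : k)
    (hc : p.eval c = 0) : c = a := by
  obtain ⟨Q, hQ⟩ := C.exists_place_above c
  have hQO : Q ≠ C.infinity := C.ne_infinity_iff.2 (C.val_x_le_one_of_takesValue hQ)
  have hQP : Q = P := by
    by_contra hne
    have h1 := Valuation.aeval_sub_lt Q.trivial_on_constants hQ p
    rw [hc, map_zero, sub_zero] at h1
    exact h1.ne (hp Q hne hQO)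
  rw [hQP] at hQ
  exact Valuation.value_unique P.trivial_on_constants hQ hP

/-- If the divisor of a polynomial in `x` of degree `ℓ₀` is `d ℓ₀ (P) - d ℓ₀ (O)`, then the order
of `P` divides `d`. -/
theorem nsmul_eq_zero_of_divisor_aeval [IsAlgClosed k] {P : Place k C.FunField}
    (hP : P.TakesValue C.x a) {p : k[X]} (hℓ : p.natDegree ≠ 0)
    (hpP : P.val (aeval C.x p) = exp (-((d : ℤ) * p.natDegree)))
    (hp : ∀ Q, Q ≠ P → Q ≠ C.infinity → Q.val (aeval C.x p) = 1) :
    d • abelJacobi C.infinity P = 0 := by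
  have hPO : P ≠ C.infinity := C.ne_infinity_iff.2 (C.val_x_le_one_of_takesValue hP)
  have hp0 : p ≠ 0 := by
    rintro rfl
    simp at hℓ
  -- Up to a constant p is a power of x - a, so the divisor of x - a is obtained by dividing that of
  -- p(x) by deg p.
  have hpe := eq_C_mul_X_sub_C_pow (eval_eq_zero_of_place_unique hP hp)
  have hval : ∀ Q : Place k C.FunField, Q.val (aeval C.x p) =
      Q.val (C.x - algebraMap k C.FunField a) ^ p.natDegree := by
    intro Q
    conv_lhs => rw [hpe]
    rw [map_mul, aeval_C, map_mul, Q.trivial_on_constants _ (leadingCoeff_ne_zero.2 hp0)]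
    simp
  refine (C.nsmul_abelJacobi_eq_zero_iff hPO d).2 ⟨C.x - algebraMap k C.FunField a, ?_, ?_, ?_⟩
  · rw [hval, show -((d : ℤ) * p.natDegree) = p.natDegree • (-(d : ℤ)) by simp; ring,
      exp_nsmul] at hpP
    exact (pow_left_inj₀ zero_le zero_le hℓ).1 hpP
  · have h1 := C.val_infinity_aeval (X_sub_C_ne_zero a)
    simpa using h1
  · intro Q hQP hQO
    have h1 := hp Q hQP hQO
    rw [hval] at h1
    exact (pow_eq_one_iff_of_nonneg zero_le hℓ).1 h1

/-- If the divisor of `y - v(x)` is `m₀ (P) - m₀ (O)`, then `v` gives a decomposition of `f`. -/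
theorem isDecomposition_of_divisor [IsAlgClosed k] (hm₀ : m₀ = d * ℓ₀) (hn : n < m₀)
    {P : Place k C.FunField} (hP : P.TakesValue C.x a) {v : k[X]} (hv : v.natDegree = ℓ₀)
    (hvP : P.val (C.y - aeval C.x v) < 1)
    (hvQ : ∀ Q, Q ≠ P → Q ≠ C.infinity → Q.val (C.y - aeval C.x v) = 1) :
    C.IsDecomposition ℓ₀ m₀ a v.leadingCoeff v := by
  -- At a root c the pair (c, v(c)) is a point of the curve, and y - v(x) vanishes there; this point
  -- can only be P.
  have hroots : ∀ c, (v ^ d - C.f).eval c = 0 → c = a := by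
    intro c hc
    rw [eval_sub, eval_pow, sub_eq_zero] at hc
    obtain ⟨Q, hQ⟩ := C.exists_place_hasCoords hc
    have hQP : Q = P := by
      by_contra hne
      exact hQ.val_y_sub_lt.ne
        (hvQ Q hne (C.ne_infinity_iff.2 (C.val_x_le_one_of_takesValue hQ.1)))
    rw [hQP] at hQ
    exact Valuation.value_unique P.trivial_on_constants hQ.1 hP
  have hdeg : C.f.natDegree < (v ^ d).natDegree := by
    rw [C.natDegree_f, natDegree_pow, hv, ← hm₀]
    exact hn
  have h1 := eq_C_mul_X_sub_C_pow hroots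
  rw [natDegree_sub_eq_left_of_natDegree_lt hdeg, natDegree_pow, hv, ← hm₀,
    leadingCoeff_sub_of_degree_lt (degree_lt_degree hdeg), leadingCoeff_pow] at h1
  have hv0 : v ≠ 0 := by
    rintro rfl
    rw [natDegree_zero] at hv
    rw [← hv, mul_zero] at hm₀
    omega
  have h2 : C.f = -Polynomial.C (v.leadingCoeff ^ d) * (X - Polynomial.C a) ^ m₀ + v ^ d := by
    linear_combination -h1
  refine ⟨leadingCoeff_ne_zero.2 hv0, hv, rfl, fun h0 => ?_, h2⟩
  have h3 := dvd_iff_isRoot.2 h0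
  have hdn := C.lt
  have hd2 := C.two_le
  -- If v(a) = 0, both summands are divisible by (X - a)², since d and m₀ are at least 2; but f is
  -- squarefree.
  have h4 : (X - Polynomial.C a) ^ 2 ∣ C.f := by
    rw [h2]
    exact dvd_add (Dvd.dvd.mul_left (pow_dvd_pow _ (by omega)) _)
      ((pow_dvd_pow_of_dvd h3 2).trans (pow_dvd_pow v hd2))
  rw [sq] at h4
  exact (irreducible_X_sub_C a).not_isUnit (C.separable_f.squarefree _ h4)

theorem exists_decomposition_of_order [IsAlgClosed k] (hm₀ : m₀ = d * ℓ₀) (hℓ₀ : 2 ≤ ℓ₀)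
    (hn : n < m₀) (hn' : m₀ < n + d) {P : Place k C.FunField} (hP : P.TakesValue C.x a)
    (hord : C.orderInJacobian P = m₀) : ∃ (B : k) (v : k[X]), C.IsDecomposition ℓ₀ m₀ a B v ∧
      C.HasCoords P a (v.eval a) := by
  have hdn := C.lt
  have hPO : P ≠ C.infinity := C.ne_infinity_iff.2 (C.val_x_le_one_of_takesValue hP)
  have h0 : m₀ • abelJacobi C.infinity P = 0 := hord ▸ addOrderOf_nsmul_eq_zero _
  obtain ⟨g, hgP, hgO, hg⟩ := (C.nsmul_abelJacobi_eq_zero_iff hPO m₀).1 h0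
  have hlt : P.val g < 1 := by
    rw [hgP, ← exp_zero, exp_lt_exp]
    omega
  obtain ⟨A, hA, rfl⟩ := C.exists_aevalAeval_of_regular (g := g) (fun Q hQ => by
    by_cases hQP : Q = P
    · rw [hQP]; exact hlt.le
    · exact (hg Q hQP hQ).le)
  -- The pole order m₀ < n + d < 2n excludes y² and higher powers.
  have hA2 : ∀ i, 2 ≤ i → A.coeff i = 0 := by
    intro i hi
    refine coeff_eq_zero_of_val_infinity_lt hA hgO.le ?_
    have : n * 2 ≤ n * i := Nat.mul_le_mul_left n hi
    exact_mod_cast (by omega : m₀ < n * i)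
  obtain ⟨j, hj, hmax, hval⟩ := C.val_infinity hA
  -- From n + d · deg ≤ m₀ < n + d the coefficient of y is constant.
  have hA1 : (A.coeff 1).natDegree = 0 := by
    by_cases hc : A.coeff 1 = 0
    · simp [hc]
    have h1 := (hmax 1 C.two_le).trans (hval.symm.le.trans hgO.le)
    rw [weight_algebraMap hc, exp_le_exp] at h1
    have h2 : d * (A.coeff 1).natDegree < d * 1 := by
      have : d * (A.coeff 1).natDegree + n * 1 ≤ m₀ := by exact_mod_cast h1
      omega
    exact Nat.lt_one_iff.1 (lt_of_mul_lt_mul_left h2 (Nat.zero_le d))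
  have hjne : A.coeff j ≠ 0 := by
    intro hc
    rw [hval, hc, map_zero, weight, if_pos rfl] at hgO
    exact exp_ne_zero hgO.symm
  rw [hval, weight_algebraMap hjne, exp_inj] at hgO
  -- The term in y has pole order n at most, so the pole of order m₀ > n comes from the polynomial
  -- in x.
  have hj0 : j = 0 := by
    by_contra hj0
    have hj1 : j = 1 := by
      by_contra hj1
      exact hjne (hA2 j (by omega))
    rw [hj1, hA1] at hgO
    have : n = m₀ := by exact_mod_cast (by simpa using hgO : (n : ℤ) = m₀)
    omega
  rw [hj0] at hgO hjne
  have hdeg : (A.coeff 0).natDegree = ℓ₀ := by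
    have h1 : d * (A.coeff 0).natDegree = d * ℓ₀ := by
      rw [← hm₀]; exact_mod_cast (by simpa using hgO : (d : ℤ) * (A.coeff 0).natDegree = m₀)
    exact Nat.eq_of_mul_eq_mul_left C.d_pos h1
  obtain ⟨e, he⟩ : ∃ e, A.coeff 1 = Polynomial.C e := ⟨_, eq_C_of_natDegree_eq_zero hA1⟩
  have hAe : A = Polynomial.C (A.coeff 0) + Polynomial.C (Polynomial.C e) * X := by
    ext1 i
    rcases i with _ | _ | i
    · simp
    · simp [he]
    · rw [hA2 _ (by omega)]
      simp
  have hAg : aevalAeval C.x C.y A = aeval C.x (A.coeff 0) + algebraMap k C.FunField e * C.y := by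
    conv_lhs => rw [hAe]
    simp only [map_add, map_mul, aevalAeval_C, aevalAeval_Y, aeval_C]
  rw [hAg] at hgP hg hlt
  -- Without y the order of P would divide d, whereas m₀ = d ℓ₀ ≥ 2d. Otherwise g is e times y -
  -- v(x), with v = -e⁻¹ A₀.
  by_cases he0 : e = 0
  · simp only [he0, map_zero, zero_mul, add_zero] at hgP hg
    have h1 := nsmul_eq_zero_of_divisor_aeval hP (p := A.coeff 0) (by omega)
      (by rw [hgP, hdeg, hm₀]; push_cast; rfl) hg
    have h2 : C.orderInJacobian P ∣ d := addOrderOf_dvd_of_nsmul_eq_zero h1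
    have h3 := Nat.le_of_dvd C.d_pos (hord ▸ h2)
    omega
  · have hval' : ∀ Q : Place k C.FunField,
        Q.val (C.y - aeval C.x (Polynomial.C (-e⁻¹) * A.coeff 0)) =
        Q.val (aeval C.x (A.coeff 0) + algebraMap k C.FunField e * C.y) := by
      intro Q
      have h1 : aeval C.x (A.coeff 0) + algebraMap k C.FunField e * C.y = algebraMap k C.FunField e *
          (C.y - aeval C.x (Polynomial.C (-e⁻¹) * A.coeff 0)) := by
        have h2 : algebraMap k C.FunField e ≠ 0 := by simpa using he0
        rw [map_mul, aeval_C, map_neg, map_inv₀]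
        field_simp
        ring
      rw [h1, map_mul Q.val, Q.trivial_on_constants e he0, one_mul]
    have hvP : P.val (C.y - aeval C.x (Polynomial.C (-e⁻¹) * A.coeff 0)) < 1 := by
      rw [hval']; exact hlt
    refine ⟨_, _, isDecomposition_of_divisor hm₀ hn hP ?_ hvP fun Q hQP hQO => ?_,
      hasCoords_of_val_y_sub_lt hP hvP⟩
    · rw [natDegree_C_mul (by simpa using he0), hdeg]
    · rw [hval']; exact hg Q hQP hQO

end Torsion

end CyclicCover

namespace CyclicCover

variable {k : Type*} [Field k] {n d : ℕ} {C : CyclicCover k n d} {ℓ₀ m₀ : ℕ} {a B : k} {v : k[X]}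

/-! ### Rational torsion points of order `m₀` -/

/-- Since d ≥ 2 is coprime to n, it does not divide n, and both inequalities for m₀ are strict. -/
theorem lt_mul_floor (C : CyclicCover k n d) (hℓ₀ : ℓ₀ = (n + d) / d) (hm₀ : m₀ = d * ℓ₀) :
    2 ≤ ℓ₀ ∧ n < m₀ ∧ m₀ < n + d := by
  have hdn := C.lt
  have hd2 := C.two_le
  have h1 := Nat.div_add_mod (n + d) d
  have h2 := Nat.mod_lt (n + d) C.d_pos
  rw [← hℓ₀, ← hm₀] at h1
  have h3 : (n + d) % d ≠ 0 := by
    intro h0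
    rw [Nat.add_mod_right] at h0
    have h4 := Nat.eq_one_of_dvd_coprimes C.coprime (Nat.dvd_of_mod_eq_zero h0) dvd_rfl
    omega
  refine ⟨?_, by omega, by omega⟩
  rw [hℓ₀, Nat.le_div_iff_mul_le C.d_pos]
  omega

theorem IsDecomposition.baseChange (K : Type*) [Field K] [Algebra k K]
    (h : C.IsDecomposition ℓ₀ m₀ a B v) :
    (C.baseChange K).IsDecomposition ℓ₀ m₀ (algebraMap k K a) (algebraMap k K B)
      (v.map (algebraMap k K)) := by
  refine ⟨by simpa using h.1, by rw [natDegree_map, h.2.1], by rw [leadingCoeff_map, h.2.2.1],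
    ?_, ?_⟩
  · rw [eval_map_algebraMap, aeval_algebraMap_apply_eq_algebraMap_eval]
    simpa using h.2.2.2.1
  · change C.f.map _ = _
    rw [h.2.2.2.2]
    simp

/-- With u = B (X - a)^ℓ₀, f = v^d - u^d = S (v - u). The d summands of S have degree at most ℓ₀(d -
1) with the same coefficient B^(d-1) there, so S has leading coefficient d B^(d-1) ≠ 0, and the
degree of q = v - u follows. -/
theorem exists_mul_geom_sum (C : CyclicCover k n d) (hn : n < m₀) (hm₀ : m₀ = d * ℓ₀)
    (h : C.IsDecomposition ℓ₀ m₀ a B v) :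
    ∃ q : k[X], q ≠ 0 ∧ (q.natDegree : ℤ) = (n : ℤ) - m₀ + ℓ₀ ∧ q.eval a ≠ 0 ∧
        v = Polynomial.C B * (X - Polynomial.C a) ^ ℓ₀ + q := by
  obtain ⟨hB, hdeg, hlc, hva, hf⟩ := h
  have hℓ : ℓ₀ ≠ 0 := by
    rintro rfl
    omega
  set u : k[X] := Polynomial.C B * (X - Polynomial.C a) ^ ℓ₀ with hu
  have hm : ((X - Polynomial.C a) ^ ℓ₀).Monic := (monic_X_sub_C a).pow ℓ₀
  have hmd : ((X - Polynomial.C a) ^ ℓ₀).natDegree = ℓ₀ := by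
    rw [(monic_X_sub_C a).natDegree_pow, natDegree_X_sub_C, mul_one]
  have hudeg : u.natDegree = ℓ₀ := by rw [hu, natDegree_C_mul hB, hmd]
  have hulc : u.coeff ℓ₀ = B := by
    rw [hu, coeff_C_mul]
    have h1 := hm.coeff_natDegree
    rw [hmd] at h1
    rw [h1, mul_one]
  have hvlc : v.coeff ℓ₀ = B := by rw [← hlc, leadingCoeff, hdeg]
  let S : k[X] := ∑ i ∈ Finset.range d, v ^ i * u ^ (d - 1 - i)
  have hS : S * (v - u) = C.f := by
    rw [(Commute.all v u).geom_sum₂_mul d, hf, hu, mul_pow, ← pow_mul, mul_comm ℓ₀ d, ← hm₀,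
      Polynomial.C_pow]
    ring
  have hf0 := C.f_ne_zero
  have hS0 : S ≠ 0 := by
    intro h0
    rw [h0, zero_mul] at hS
    exact hf0 hS.symm
  have hq0 : v - u ≠ 0 := by
    intro h0
    rw [h0, mul_zero] at hS
    exact hf0 hS.symm
  have hSdeg : S.natDegree = ℓ₀ * (d - 1) := by
    have hterm : ∀ i ∈ Finset.range d, (v ^ i * u ^ (d - 1 - i)).natDegree ≤ ℓ₀ * (d - 1) ∧
        (v ^ i * u ^ (d - 1 - i)).coeff (ℓ₀ * (d - 1)) = B ^ (d - 1) := by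
      intro i hi
      have hi' : i + (d - 1 - i) = d - 1 := by have := Finset.mem_range.1 hi; omega
      have e1 : (v ^ i).natDegree ≤ i * ℓ₀ := by rw [natDegree_pow, hdeg]
      have e2 : (u ^ (d - 1 - i)).natDegree ≤ (d - 1 - i) * ℓ₀ := by rw [natDegree_pow, hudeg]
      have e3 : ℓ₀ * (d - 1) = i * ℓ₀ + (d - 1 - i) * ℓ₀ := by rw [← add_mul, hi', mul_comm]
      refine ⟨e3 ▸ natDegree_mul_le_of_le e1 e2, ?_⟩
      rw [e3, coeff_mul_add_eq_of_natDegree_le e1 e2, coeff_pow_of_natDegree_le hdeg.le,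
        coeff_pow_of_natDegree_le hudeg.le, hvlc, hulc, ← pow_add, hi']
    refine natDegree_eq_of_le_of_coeff_ne_zero
      (natDegree_sum_le_of_forall_le _ _ fun i hi => (hterm i hi).1) ?_
    rw [finsetSum_coeff, Finset.sum_congr rfl fun i hi => (hterm i hi).2]
    simpa using ⟨C.char_not_dvd, fun h0 => absurd h0 hB⟩
  refine ⟨v - u, hq0, ?_, ?_, by ring⟩
  · have h1 := congrArg natDegree hS
    rw [natDegree_mul hS0 hq0, hSdeg, C.natDegree_f] at h1
    have hd := C.d_pos
    obtain ⟨e, rfl⟩ : ∃ e, d = e + 1 := ⟨d - 1, by omega⟩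
    rw [hm₀, ← h1, Nat.add_sub_cancel]
    push_cast
    ring
  · rw [eval_sub, hu]
    simpa [hℓ] using hva

section

variable {K : Type*} [Field K] [IsAlgClosed K] [Algebra k K]

theorem rational_torsion_iff (C : CyclicCover k n d) (hℓ₀ : ℓ₀ = (n + d) / d) (hm₀ : m₀ = d * ℓ₀)
    (a : k) (P : Place K (C.baseChange K).FunField) :
    (C.IsRational P ∧ (C.baseChange K).orderInJacobian P = m₀ ∧
        P.TakesValue (C.baseChange K).x (algebraMap k K a)) ↔
      ∃ (B : k) (v : k[X]), C.IsDecomposition ℓ₀ m₀ a B v ∧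
        (C.baseChange K).HasCoords P (algebraMap k K a) (algebraMap k K (v.eval a)) := by
  obtain ⟨hℓ, hn, hn'⟩ := C.lt_mul_floor hℓ₀ hm₀
  have hinj := Polynomial.map_injective _ (algebraMap k K).injective
  constructor
  · rintro ⟨hrat, hord, hP⟩
    obtain ⟨B, v, hv, hPv⟩ := exists_decomposition_of_order hm₀ hℓ hn hn' hP hord
    obtain ⟨c, hc⟩ := hrat C.y (by
      rw [funBaseChange_y]
      exact (C.baseChange K).val_y_le_one ((C.baseChange K).val_x_le_one_of_takesValue hP))
    rw [funBaseChange_y] at hc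
    have hvc := Valuation.value_unique P.trivial_on_constants hPv.2 hc
    have hc0 : c ≠ 0 := by
      rintro rfl
      exact hv.2.2.2.1 (by rw [hvc, map_zero])
    have hf : C.f.map (algebraMap k K) = _ := hv.2.2.2.2
    -- The congruence v^d ≡ f holds modulo (X - a)^m₀ and m₀ > ℓ₀ = deg v, so it determines every
    -- coefficient of v, and in particular B.
    obtain ⟨v₀, rfl⟩ := (mem_lifts _).1 (mem_lifts_of_pow (f := C.f) (N := m₀)
      (r := Polynomial.C (B ^ d)) (C.baseChange K).char_not_dvd hc0 hvc
      (by rw [hv.2.1]; nlinarith [C.two_le]) (by rw [hf]; ring))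
    have hlc := hv.2.2.1
    rw [leadingCoeff_map] at hlc
    have hev : (v₀.map (algebraMap k K)).eval (algebraMap k K a) = algebraMap k K (v₀.eval a) := by
      rw [eval_map_algebraMap, aeval_algebraMap_apply_eq_algebraMap_eval]
    refine ⟨v₀.leadingCoeff, v₀, ⟨?_, ?_, rfl, ?_, hinj ?_⟩, hev ▸ hPv⟩
    · intro h0
      exact hv.1 (by rw [← hlc, h0, map_zero])
    · simpa using hv.2.1
    · intro h0
      exact hv.2.2.2.1 (by rw [hev, h0, map_zero])
    · rw [hf, ← hlc]
      simp
  · rintro ⟨B, v, hv, hP⟩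
    have hev : (v.map (algebraMap k K)).eval (algebraMap k K a) = algebraMap k K (v.eval a) := by
      rw [eval_map_algebraMap, aeval_algebraMap_apply_eq_algebraMap_eval]
    exact ⟨hP.isRational hv.2.2.2.1,
      orderInJacobian_of_decomposition hm₀ hn hn' (hv.baseChange K) (hev ▸ hP), hP.1⟩

theorem IsDecomposition.exists_place (h : C.IsDecomposition ℓ₀ m₀ a B v) (hm₀ : m₀ ≠ 0) :
    ∃ P : Place K (C.baseChange K).FunField,
      (C.baseChange K).HasCoords P (algebraMap k K a) (algebraMap k K (v.eval a)) := by
  refine (C.baseChange K).exists_place_hasCoords ?_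
  change _ = (C.f.map _).eval _
  rw [eval_map_algebraMap, aeval_algebraMap_apply_eq_algebraMap_eval, ← map_pow, h.2.2.2.2]
  simp [hm₀]

end

/-! ### Translation of the curve -/

/-- The curve obtained from `C` by the change of coordinates `x₁ = x - a`, `y₁ = y / b`. -/
noncomputable def translate (C : CyclicCover k n d) (a : k) {b : k} (hb : b ≠ 0) :
    CyclicCover k n d where
  f := Polynomial.C (b ^ d)⁻¹ * C.f.comp (X + Polynomial.C a)
  two_le := C.two_le
  lt := C.lt
  coprime := C.coprime
  char_not_dvd := C.char_not_dvd
  natDegree_f := by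
    rw [natDegree_C_mul (inv_ne_zero (pow_ne_zero _ hb)), natDegree_comp, natDegree_X_add_C,
      mul_one, C.natDegree_f]
  separable_f := by
    have h1 : (C.f.comp (X + Polynomial.C a)).Separable := by
      have h2 := IsCoprime.map C.separable_f (compRingHom (X + Polynomial.C a))
      rw [Separable, derivative_comp]
      simpa using h2
    have h3 : IsUnit (Polynomial.C (b ^ d)⁻¹) :=
      isUnit_C.2 (isUnit_iff_ne_zero.2 (inv_ne_zero (pow_ne_zero _ hb)))
    rw [Separable, derivative_C_mul]
    exact (isCoprime_mul_unit_left h3 _ _).2 h1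

/-! ### The change of coordinates on the affine curve -/

theorem coordY_pow (C : CyclicCover k n d) : C.coordY ^ d = aeval C.coordX C.f := by
  have h := AdjoinRoot.eval₂_root ((X : k[X][X]) ^ d - Polynomial.C C.f)
  rw [eval₂_sub, eval₂_pow, eval₂_X, eval₂_C, sub_eq_zero] at h
  refine h.trans ?_
  have h1 : AdjoinRoot.of ((X : k[X][X]) ^ d - Polynomial.C C.f) =
      (aeval (R := k) C.coordX : k[X] →ₐ[k] C.CoordRing).toRingHom := by
    refine Polynomial.ringHom_ext (fun c => ?_) ?_
    · simp only [AlgHom.toRingHom_eq_coe, RingHom.coe_coe, aeval_C]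
      rfl
    · simp [coordX]
  exact RingHom.congr_fun h1 _

theorem coordRing_hom_ext (C : CyclicCover k n d) {R : Type*} [CommRing R]
    {φ ψ : C.CoordRing →+* R}
    (hc : ∀ c : k, φ (algebraMap k C.CoordRing c) = ψ (algebraMap k C.CoordRing c))
    (hx : φ C.coordX = ψ C.coordX) (hy : φ C.coordY = ψ C.coordY) : φ = ψ :=
  AdjoinRoot.ringHom_ext (Polynomial.ringHom_ext hc hx) hy

theorem coordRing_algHom_ext (C : CyclicCover k n d) {R : Type*} [CommRing R] [Algebra k R]
    {φ ψ : C.CoordRing →ₐ[k] R}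
    (hx : φ C.coordX = ψ C.coordX) (hy : φ C.coordY = ψ C.coordY) : φ = ψ :=
  AlgHom.coe_ringHom_injective (C.coordRing_hom_ext (by simp) hx hy)

variable {C' : CyclicCover k n d}

/-- The homomorphism of coordinate rings that sends `x` to `x - a` and `y` to `b⁻¹ y`. -/
noncomputable def coordSubstHom (a b : k)
    (h : C'.f = Polynomial.C (b ^ d)⁻¹ * C.f.comp (X + Polynomial.C a)) :
    C'.CoordRing →ₐ[k] C.CoordRing :=
  AdjoinRoot.liftAlgHom _ (aeval (C.coordX - algebraMap k C.CoordRing a))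
    (algebraMap k C.CoordRing b⁻¹ * C.coordY) (by
      rw [eval₂_sub, eval₂_pow, eval₂_X, eval₂_C, RingHom.coe_coe, mul_pow, coordY_pow, h,
        map_mul, aeval_C, aeval_comp, ← map_pow, inv_pow]
      simp)

theorem coordSubstHom_x (a b : k)
    (h : C'.f = Polynomial.C (b ^ d)⁻¹ * C.f.comp (X + Polynomial.C a)) :
    coordSubstHom a b h C'.coordX = C.coordX - algebraMap k C.CoordRing a :=
  (AdjoinRoot.liftAlgHom_of ..).trans (aeval_X _)

theorem coordSubstHom_y (a b : k)
    (h : C'.f = Polynomial.C (b ^ d)⁻¹ * C.f.comp (X + Polynomial.C a)) :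
    coordSubstHom a b h C'.coordY = algebraMap k C.CoordRing b⁻¹ * C.coordY :=
  AdjoinRoot.liftAlgHom_root ..

/-- The isomorphism of coordinate rings that sends `x` to `x - a` and `y` to `b⁻¹ y`. -/
noncomputable def coordSubstEquiv (a : k) {b : k} (hb : b ≠ 0)
    (h : C'.f = Polynomial.C (b ^ d)⁻¹ * C.f.comp (X + Polynomial.C a)) :
    C'.CoordRing ≃ₐ[k] C.CoordRing :=
  AlgEquiv.ofAlgHom (coordSubstHom a b h) (coordSubstHom (-a) b⁻¹ (subst_symm hb h))
    (coordRing_algHom_ext C (by simp [coordSubstHom_x]) (by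
      simp only [AlgHom.comp_apply, coordSubstHom_y, map_mul, AlgHom.commutes, AlgHom.id_apply,
        ← mul_assoc, inv_inv]
      rw [← map_mul, mul_inv_cancel₀ hb]
      simp))
    (coordRing_algHom_ext C' (by simp [coordSubstHom_x]) (by
      simp only [AlgHom.comp_apply, coordSubstHom_y, map_mul, AlgHom.commutes, AlgHom.id_apply,
        ← mul_assoc, inv_inv]
      rw [← map_mul, inv_mul_cancel₀ hb]
      simp))

theorem coordToFun_x (C : CyclicCover k n d) : C.coordToFun C.coordX = C.x :=
  (AdjoinRoot.map_of ..).trans (congrArg _ RatFunc.algebraMap_X)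

theorem coordToFun_y (C : CyclicCover k n d) : C.coordToFun C.coordY = C.y :=
  AdjoinRoot.map_root ..

theorem coordToFun_algebraMap (C : CyclicCover k n d) (c : k) :
    C.coordToFun (algebraMap k C.CoordRing c) = algebraMap k C.FunField c := by
  have h1 : algebraMap k C.CoordRing c =
      AdjoinRoot.of ((X : k[X][X]) ^ d - Polynomial.C C.f) (Polynomial.C c) := rfl
  rw [h1, ← aeval_C C.x, ← of_algebraMap]
  exact AdjoinRoot.map_of ..

theorem substEquiv_coordToFun (a : k) {b : k} (hb : b ≠ 0)
    (h : C'.f = Polynomial.C (b ^ d)⁻¹ * C.f.comp (X + Polynomial.C a)) (g : C'.CoordRing) :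
    substEquiv a hb h (C'.coordToFun g) = C.coordToFun (coordSubstEquiv a hb h g) := by
  have h1 : ((substEquiv a hb h : C'.FunField ≃ₐ[k] C.FunField) : C'.FunField →+* C.FunField).comp
      C'.coordToFun = C.coordToFun.comp
        (coordSubstEquiv a hb h : C'.CoordRing ≃ₐ[k] C.CoordRing) := by
    refine C'.coordRing_hom_ext (fun c => ?_) ?_ ?_
    · simp [coordToFun_algebraMap]
    · have h2 : coordSubstEquiv a hb h C'.coordX = C.coordX - algebraMap k C.CoordRing a :=
        coordSubstHom_x a b h
      simp [coordToFun_algebraMap, coordToFun_x, substEquiv_x, h2]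
    · have h2 : coordSubstEquiv a hb h C'.coordY = algebraMap k C.CoordRing b⁻¹ * C.coordY :=
        coordSubstHom_y a b h
      simp [coordToFun_algebraMap, coordToFun_y, substEquiv_y, h2]
  exact RingHom.congr_fun h1 g

/-! ### The change of coordinates on the smooth models -/

theorem subst_baseChange (K : Type*) [Field K] [Algebra k K] {b : k}
    (h : C'.f = Polynomial.C (b ^ d)⁻¹ * C.f.comp (X + Polynomial.C a)) :
    (C'.baseChange K).f = Polynomial.C (algebraMap k K b ^ d)⁻¹ *
      (C.baseChange K).f.comp (X + Polynomial.C (algebraMap k K a)) := by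
  change C'.f.map _ = _ * (C.f.map _).comp _
  rw [h]
  simp [map_comp]

/-- The isomorphism of curves `(x, y) ↦ (x - a, y / b)`. -/
noncomputable def substIso (K : Type*) [Field K] [Algebra k K] (a : k) {b : k} (hb : b ≠ 0)
    (h : C'.f = Polynomial.C (b ^ d)⁻¹ * C.f.comp (X + Polynomial.C a)) : Iso C C' K where
  onPoints :=
    { toFun := fun P => P.comap (substEquiv (algebraMap k K a) (by simpa using hb)
        (subst_baseChange K h))
      invFun := fun P => P.comap (substEquiv (algebraMap k K a) (by simpa using hb)
        (subst_baseChange K h)).symm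
      left_inv := fun P => Place.ext (Valuation.ext fun g => by simp [Place.comap_val])
      right_inv := fun P => Place.ext (Valuation.ext fun g => by simp [Place.comap_val]) }
  pullback := substEquiv (algebraMap k K a) (by simpa using hb) (subst_baseChange K h)
  pullbackBase := substEquiv a hb h
  val_onPoints _ _ := rfl
  pullback_base g := by
    have h1 : ((substEquiv (algebraMap k K a) (by simpa using hb) (subst_baseChange K h) :
        (C'.baseChange K).FunField ≃ₐ[K] (C.baseChange K).FunField) :
        (C'.baseChange K).FunField →+* (C.baseChange K).FunField).comp (C'.funBaseChange K) =
        (C.funBaseChange K).comp (substEquiv a hb h : C'.FunField ≃ₐ[k] C.FunField) := by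
      refine C'.funField_hom_ext (fun c => ?_) ?_ ?_
      · simp [funBaseChange_algebraMap]
      · simp [funBaseChange_algebraMap, funBaseChange_x, substEquiv_x]
      · simp [funBaseChange_algebraMap, funBaseChange_y, substEquiv_y]
    exact RingHom.congr_fun h1 g

/-- O is characterized by the pole of x, and x - a has a pole wherever x has one. -/
theorem substIso_infinity (K : Type*) [Field K] [Algebra k K] (a : k) {b : k} (hb : b ≠ 0)
    (h : C'.f = Polynomial.C (b ^ d)⁻¹ * C.f.comp (X + Polynomial.C a)) :
    (substIso K a hb h).onPoints (C.baseChange K).infinity = (C'.baseChange K).infinity := by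
  refine (C'.baseChange K).eq_infinity ?_
  rw [Iso.val_onPoints]
  simp only [substIso, substEquiv_x]
  have h1 := (C.baseChange K).one_lt_val_infinity_x
  rwa [Valuation.map_sub_eq_of_lt_left]
  exact (Valuation.map_algebraMap_le_one
    (C.baseChange K).infinity.trivial_on_constants _).trans_lt h1

theorem hasCoords_substIso {K : Type*} [Field K] [Algebra k K] {b : k} (hb : b ≠ 0)
    (h : C'.f = Polynomial.C (b ^ d)⁻¹ * C.f.comp (X + Polynomial.C a))
    {P : Place K (C.baseChange K).FunField}
    (hP : (C.baseChange K).HasCoords P (algebraMap k K a) (algebraMap k K b)) :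
    (C'.baseChange K).HasCoords ((substIso K a hb h).onPoints P) 0 1 := by
  have hb' : algebraMap k K b ≠ 0 := by simpa using hb
  constructor
  · rw [Place.TakesValue, Iso.val_onPoints, map_zero, sub_zero]
    simp only [substIso, substEquiv_x]
    exact hP.1
  · rw [Place.TakesValue, Iso.val_onPoints, map_one, map_sub, map_one]
    simp only [substIso, substEquiv_y]
    have h1 : algebraMap K (C.baseChange K).FunField (algebraMap k K b)⁻¹ * (C.baseChange K).y - 1 =
        algebraMap K (C.baseChange K).FunField (algebraMap k K b)⁻¹ * ((C.baseChange K).y -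
          algebraMap K (C.baseChange K).FunField (algebraMap k K b)) := by
      rw [mul_sub, ← map_mul, inv_mul_cancel₀ hb', map_one]
    rw [h1, map_mul, P.trivial_on_constants _ (inv_ne_zero hb'), one_mul]
    exact hP.2

theorem IsDecomposition.translate_of_eval_eq {b : k} (hb : v.eval a = b) (hb0 : b ≠ 0)
    (h : C.IsDecomposition ℓ₀ m₀ a B v) :
    (C.translate a hb0).IsDecomposition ℓ₀ m₀ 0 (B / b)
      (Polynomial.C b⁻¹ * v.comp (X + Polynomial.C a)) := by
  obtain ⟨hB, hdeg, hlc, hva, hf⟩ := h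
  have hbi := inv_ne_zero hb0
  refine ⟨div_ne_zero hB hb0, ?_, ?_, ?_, ?_⟩
  · rw [natDegree_C_mul hbi, natDegree_comp, natDegree_X_add_C, mul_one, hdeg]
  · rw [leadingCoeff_mul, leadingCoeff_C, leadingCoeff_comp (by simp), hlc,
      (monic_X_add_C a).leadingCoeff, one_pow, mul_one, div_eq_inv_mul]
  · simp [hb, hb0]
  · change Polynomial.C (b ^ d)⁻¹ * C.f.comp (X + Polynomial.C a) = _
    rw [hf, div_pow, div_eq_inv_mul, mul_pow, ← Polynomial.C_pow, inv_pow, Polynomial.C_mul]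
    simp
    ring

end CyclicCover

/-! ### The theorem -/

theorem mainTheorem5 {K₀ K : Type*} [Field K₀] [PerfectField K₀] [Field K] [IsAlgClosed K]
    [Algebra K₀ K] {n d : ℕ} (C : CyclicCover K₀ n d) (ℓ₀ m₀ : ℕ)
    (hℓ₀ : ℓ₀ = (n + d) / d) (hm₀ : m₀ = d * ℓ₀) (hn : 0 ≤ (n : ℤ) - m₀ + ℓ₀) (a : K₀) :
    -- (1), for a given point `P`
    (∀ P : Place K (C.baseChange K).FunField,
      (C.IsRational P ∧ (C.baseChange K).orderInJacobian P = m₀ ∧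
          P.TakesValue (C.baseChange K).x (algebraMap K₀ K a)) ↔
        ∃ (B : K₀) (v : K₀[X]), C.IsDecomposition ℓ₀ m₀ a B v ∧
          (C.baseChange K).HasCoords P (algebraMap K₀ K a) (algebraMap K₀ K (v.eval a))) ∧
    -- (1), the existence of a point
    ((∃ P : Place K (C.baseChange K).FunField,
        C.IsRational P ∧ (C.baseChange K).orderInJacobian P = m₀ ∧
          P.TakesValue (C.baseChange K).x (algebraMap K₀ K a)) ↔
      ∃ (B : K₀) (v : K₀[X]), C.IsDecomposition ℓ₀ m₀ a B v) ∧
    -- (1), the additional assertion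
    (∀ (B : K₀) (v : K₀[X]), C.IsDecomposition ℓ₀ m₀ a B v →
      ∃ q : K₀[X], q ≠ 0 ∧ (q.natDegree : ℤ) = (n : ℤ) - m₀ + ℓ₀ ∧ q.eval a ≠ 0 ∧
        v = Polynomial.C B * (X - Polynomial.C a) ^ ℓ₀ + q) ∧
    -- (2)
    (∀ (B : K₀) (v q h w r : K₀[X]) (B' : K₀) (P : Place K (C.baseChange K).FunField),
      C.IsDecomposition ℓ₀ m₀ a B v →
      (C.baseChange K).HasCoords P (algebraMap K₀ K a) (algebraMap K₀ K (v.eval a)) →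
      v = Polynomial.C B * (X - Polynomial.C a) ^ ℓ₀ + q →
      h = Polynomial.C ((v.eval a) ^ d)⁻¹ * C.f.comp (X + Polynomial.C a) →
      w = Polynomial.C (v.eval a)⁻¹ * v.comp (X + Polynomial.C a) →
      r = Polynomial.C (v.eval a)⁻¹ * q.comp (X + Polynomial.C a) →
      B' = B / v.eval a →
      -- (a)
      (h.natDegree = n ∧ h.Separable ∧
        h = -Polynomial.C (B' ^ d) * X ^ m₀ + w ^ d ∧ w = Polynomial.C B' * X ^ ℓ₀ + r) ∧
      -- (b)
      (w.natDegree = ℓ₀ ∧ (r.natDegree : ℤ) = (n : ℤ) - m₀ + ℓ₀ ∧ r.natDegree < ℓ₀ ∧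
        w.eval 0 = 1 ∧ r ≠ 0) ∧
      -- (c) and (d)
      ∃ C' : CyclicCover K₀ n d, C'.f = h ∧
        ∃ (φ : C'.CoordRing ≃ₐ[K₀] C.CoordRing) (Φ : CyclicCover.Iso C C' K)
          (Q : Place K (C'.baseChange K).FunField),
          φ C'.coordX = C.coordX - algebraMap K₀ C.CoordRing a ∧
          φ C'.coordY = algebraMap K₀ C.CoordRing (v.eval a)⁻¹ * C.coordY ∧
          (∀ g, Φ.pullbackBase (C'.coordToFun g) = C.coordToFun (φ g)) ∧
          Φ.onPoints (C.baseChange K).infinity = (C'.baseChange K).infinity ∧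
          (∀ R, (C'.baseChange K).HasCoords R 0 1 ↔ R = Q) ∧
          Φ.onPoints P = Q ∧
          C'.IsRational Q ∧ (C'.baseChange K).orderInJacobian Q = m₀) := by
  obtain ⟨hℓ, hnm, hnm'⟩ := C.lt_mul_floor hℓ₀ hm₀
  have hiff := C.rational_torsion_iff (K := K) hℓ₀ hm₀ a
  refine ⟨hiff, ⟨?_, ?_⟩, fun B v hv => C.exists_mul_geom_sum hnm hm₀ hv, ?_⟩
  · rintro ⟨P, hP⟩
    obtain ⟨B, v, hv, -⟩ := (hiff P).1 hP
    exact ⟨B, v, hv⟩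
  · rintro ⟨B, v, hv⟩
    obtain ⟨P, hP⟩ := hv.exists_place (K := K) (by omega)
    exact ⟨P, (hiff P).2 ⟨B, v, hv, hP⟩⟩
  · rintro B v q h w r B' P hv hP hq rfl rfl rfl rfl
    have hb := hv.2.2.2.1
    have hbi := inv_ne_zero hb
    have hdec := hv.translate_of_eval_eq rfl hb
    obtain ⟨q', hq0, hqdeg, hqa, hq'⟩ := C.exists_mul_geom_sum hnm hm₀ hv
    -- The equation v = B (X - a)^ℓ₀ + q determines q, so the given q has the degree found in (1).
    obtain rfl : q = q' := add_left_cancel (hq.symm.trans hq')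
    have hrdeg : (Polynomial.C (v.eval a)⁻¹ * q.comp (X + Polynomial.C a)).natDegree =
        q.natDegree := by
      rw [natDegree_C_mul hbi, natDegree_comp, natDegree_X_add_C, mul_one]
    refine ⟨⟨(C.translate a hb).natDegree_f, (C.translate a hb).separable_f, ?_, ?_⟩,
      ⟨hdec.2.1, by rw [hrdeg, hqdeg], by rw [hrdeg]; omega, by simp [hb], ?_⟩, ?_⟩
    · have h1 := hdec.2.2.2.2
      rwa [Polynomial.C_0, sub_zero] at h1
    · have h1 := congrArg (fun p => p.comp (X + Polynomial.C a)) hq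
      simp only [add_comp, mul_comp, C_comp, pow_comp, sub_comp, X_comp, add_sub_cancel_right] at h1
      rw [h1, div_eq_inv_mul, Polynomial.C_mul]
      ring
    · refine mul_ne_zero (by simpa using hb) fun h0 => hq0 ?_
      have h1 := congrArg (fun p => p.comp (X - Polynomial.C a)) h0
      simpa [comp_assoc] using h1
    · have hQ := CyclicCover.hasCoords_substIso (C' := C.translate a hb) hb rfl hP
      refine ⟨C.translate a hb, rfl, CyclicCover.coordSubstEquiv a hb rfl,
        CyclicCover.substIso K a hb rfl, _, CyclicCover.coordSubstHom_x (C' := C.translate a hb) _ _ rfl,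
        CyclicCover.coordSubstHom_y (C' := C.translate a hb) _ _ rfl, CyclicCover.substEquiv_coordToFun a hb rfl,
        CyclicCover.substIso_infinity K a hb rfl, fun R => ⟨fun hR => ?_, ?_⟩, rfl, ?_⟩
      · exact hR.place_unique hQ one_ne_zero
      · rintro rfl
        exact hQ
      -- Assertion (d) is the criterion of (1) for the translated curve, with base value 0 and the
      -- decomposition given by w, for which w(0) = 1.
      · have h1 := ((C.translate a hb).rational_torsion_iff (K := K) hℓ₀ hm₀ 0 _).2
          ⟨_, _, hdec, by simpa [hb] using hQ⟩
        exact ⟨h1.1, h1.2.1⟩
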